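/- Conventions: algebras are nonempty. For an algebra $\mathbf A$, the flat extension $\flat(\mathbf A)$ with $0$ has universe $A\cup\{0\}$ with $0\notin A$; its operations are those of $\mathbf A$, extended so that $0$ is absorbing, a further binary operation $\wedge$ with $x\wedge y=x$ if $x=y$ and $x\wedge y=0$ otherwise, and the constant $0$. A universal Horn sentence is a universally quantified conjunction of disjunctions of atomic and negated atomic formulas, each disjunction having at most one non-negated disjunct. The universal Horn theory of $\mathbf A$ is the set of universal Horn sentences true in $\mathbf A$; it has a finite basis if it is entailed by a finite subset of itself. Lattices are algebras with the operations meet and join. Let $M_{3-3}$ be the 10-element lattice consisting of a lower copy $l_0<l_a,l_b,l_c<l_1$ and an upper copy $u_0<u_a,u_b,u_c<u_1$ of the lattice $M_3$, together with the coverings $l_c<u_0$ and $l_1<u_a$. Sentences are first order, and the quantifier prefix of a prenex sentence may have empty blocks. (1) Let $\mathbf L$ be a finite lattice whose universal Horn theory has no finite basis. Then the variety $\mathsf{HSP}(\flat(\mathbf L))$ generated by $\flat(\mathbf L)$ with $0$ has no finite equational basis, and it is not the class of models of any first order sentence; but there is a $\forall^*\exists^*\forall^*$ sentence $\Phi$ such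 that a finite algebra of the signature of $\flat(\mathbf L)$ lies in $\mathsf{HSP}(\flat(\mathbf L))$ if and only if it satisfies $\Phi$. (2) (Belkin) The universal Horn theory of $M_{3-3}$ has no finite basis. (3) The first order Eilenberg–Schützenberger problem has a negative answer: it is not true that whenever a finite algebra of finite signature generates a variety that is not axiomatisable by a first order sentence, the class of finite members of this variety is not definable amongst finite algebras by a first order sentence. (4) The Łoś–Tarski, $\mathsf{SP}$- and $\mathsf{HSP}$-preservation theorems fail simultaneously at the finite level: there is a $\forall^*\exists^*\forall^*$ sentence $\Phi$ whose finite models are exactly the finite members of $\mathsf{HSP}(\flat(M_{3-3}))$, such that the class of finite models of $\Phi$ is closed under homomorphic images, isomorphic copies of subalgebras and finitary direct products, but no universal sentence, no universal Horn sentence, no finite set of equations, and indeed no $\forall^*\exists^*$ sentence has the same finite models as $\Phi$. -/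

import Mathlib

open FirstOrder

namespace FlatLattice

/-! ### Prenex classes and universal Horn sentences -/

section Prenex

variable {L : FirstOrder.Language.{0, 0}}

/-- Prenex formulas of the form `∀* ∃*` over a quantifier-free formula (blocks may be empty). -/
inductive IsForallExists : ∀ {n : ℕ}, L.BoundedFormula Empty n → Prop
  | of_isExistential {n : ℕ} {φ : L.BoundedFormula Empty n} (h : φ.IsExistential) :
      IsForallExists φ
  | all {n : ℕ} {φ : L.BoundedFormula Empty (n + 1)} (h : IsForallExists φ) :
      IsForallExists φ.all

/-- Prenex formulas of the form `∃* ∀*` over a quantifier-free formula (blocks may be empty). -/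
inductive IsExistsForall : ∀ {n : ℕ}, L.BoundedFormula Empty n → Prop
  | of_isUniversal {n : ℕ} {φ : L.BoundedFormula Empty n} (h : φ.IsUniversal) :
      IsExistsForall φ
  | ex {n : ℕ} {φ : L.BoundedFormula Empty (n + 1)} (h : IsExistsForall φ) :
      IsExistsForall φ.ex

/-- Prenex formulas of the form `∀* ∃* ∀*` over a quantifier-free formula
(blocks may be empty). -/
inductive IsForallExistsForall : ∀ {n : ℕ}, L.BoundedFormula Empty n → Prop
  | of_isExistsForall {n : ℕ} {φ : L.BoundedFormula Empty n} (h : IsExistsForall φ) :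
      IsForallExistsForall φ
  | all {n : ℕ} {φ : L.BoundedFormula Empty (n + 1)} (h : IsForallExistsForall φ) :
      IsForallExistsForall φ.all

/-- Horn clauses `¬α₁ ∨ … ∨ ¬αₖ ∨ β` with `αᵢ` atomic and `β` atomic or absent, written
in the implicational form `α₁ → … → αₖ → β`, respectively `α₁ → … → αₖ → ⊥`. -/
inductive IsHornClause {n : ℕ} : L.BoundedFormula Empty n → Prop
  | atomic {φ : L.BoundedFormula Empty n} (h : φ.IsAtomic) : IsHornClause φ
  | falsum : IsHornClause ⊥
  | imp {α φ : L.BoundedFormula Empty n} (hα : α.IsAtomic) (hφ : IsHornClause φ) :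
      IsHornClause (α.imp φ)

/-- Conjunctions of Horn clauses. -/
inductive IsHorn {n : ℕ} : L.BoundedFormula Empty n → Prop
  | clause {φ : L.BoundedFormula Empty n} (h : IsHornClause φ) : IsHorn φ
  | and {φ ψ : L.BoundedFormula Empty n} (hφ : IsHorn φ) (hψ : IsHorn ψ) : IsHorn (φ ⊓ ψ)

/-- Universally quantified conjunctions of Horn clauses. -/
inductive IsUniversalHorn : ∀ {n : ℕ}, L.BoundedFormula Empty n → Prop
  | of_isHorn {n : ℕ} {φ : L.BoundedFormula Empty n} (h : IsHorn φ) : IsUniversalHorn φ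
  | all {n : ℕ} {φ : L.BoundedFormula Empty (n + 1)} (h : IsUniversalHorn φ) :
      IsUniversalHorn φ.all

end Prenex

/-- The universal Horn theory of `A` (the set of universal Horn sentences true in `A`) has a
finite basis: some finite subset of it has all of it as logical consequences. -/
def HasFiniteUniversalHornBasis (L : FirstOrder.Language.{0, 0}) (A : Type) [L.Structure A] : Prop :=
  ∃ T : Finset L.Sentence,
    (∀ φ ∈ T, IsUniversalHorn φ ∧ A ⊨ φ) ∧
    ∀ (M : Type) [Nonempty M] [L.Structure M], (∀ φ ∈ T, M ⊨ φ) →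
      ∀ ψ : L.Sentence, IsUniversalHorn ψ → A ⊨ ψ → M ⊨ ψ

/-! ### Products, varieties, equations -/

/-- The direct product of a family of structures. -/
instance piStructure {L : FirstOrder.Language.{0, 0}} {I : Type} (A : I → Type)
    [∀ i, L.Structure (A i)] : L.Structure (∀ i, A i) where
  funMap f x := fun i => FirstOrder.Language.Structure.funMap f (fun j => x j i)
  RelMap r x := ∀ i, FirstOrder.Language.Structure.RelMap r (fun j => x j i)

/-- `A ∈ HSP(B)`: the algebra `A` is a homomorphic image of a subalgebra of a power of `B`. -/
def MemVariety (L : FirstOrder.Language.{0, 0}) (B A : Type) [L.Structure B] [L.Structure A] : Prop :=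
  ∃ (I : Type) (S : L.Substructure (I → B)) (f : S →[L] A), Function.Surjective f

/-- An equation: a pair of terms in variables `x₀, x₁, …`. -/
abbrev Equation (L : FirstOrder.Language.{0, 0}) : Type := L.Term ℕ × L.Term ℕ

/-- The equation `e` holds in `A` under all assignments. -/
def SatisfiesEquation {L : FirstOrder.Language.{0, 0}} (A : Type) [L.Structure A] (e : Equation L) : Prop :=
  ∀ v : ℕ → A, e.1.realize v = e.2.realize v

/-- The variety `HSP(B)` is finitely based: it is the class of models of finitely many
equations. -/
def VarietyFinitelyBased (L : FirstOrder.Language.{0, 0}) (B : Type) [L.Structure B] : Prop :=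
  ∃ E : Finset (Equation L), ∀ (A : Type) [Nonempty A] [L.Structure A],
    (∀ e ∈ E, SatisfiesEquation A e) ↔ MemVariety L B A

/-- The variety `HSP(B)` is the class of models of a single first order sentence. -/
def VarietyFirstOrderAxiomatisable (L : FirstOrder.Language.{0, 0}) (B : Type) [L.Structure B] : Prop :=
  ∃ Φ : L.Sentence, ∀ (A : Type) [Nonempty A] [L.Structure A],
    A ⊨ Φ ↔ MemVariety L B A

/-- Amongst finite algebras, the sentence `Φ` defines the class of finite members of
`HSP(B)`. -/
def DefinesFiniteMembers {L : FirstOrder.Language.{0, 0}} (B : Type) [L.Structure B]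
    (Φ : L.Sentence) : Prop :=
  ∀ (A : Type) [Finite A] [Nonempty A] [L.Structure A], A ⊨ Φ ↔ MemVariety L B A

/-- The positive answer to the first order Eilenberg–Schützenberger problem: whenever a finite
algebra of finite signature generates a variety without a finite axiomatisation in first order
logic, the finite part of this variety has no finite axiomatisation in first order logic
(amongst finite algebras). -/
def FirstOrderEilenbergSchutzenberger : Prop :=
  ∀ (L : FirstOrder.Language.{0, 0}) [L.IsAlgebraic] [Finite (Σ n, L.Functions n)]
    (B : Type) [Finite B] [Nonempty B] [L.Structure B],
    ¬ VarietyFirstOrderAxiomatisable L B → ¬ ∃ Φ : L.Sentence, DefinesFiniteMembers B Φ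

/-! ### Preservation theorems at the finite level -/

section Preservation

variable {L : FirstOrder.Language.{0, 0}}

/-- `Φ` and `Ψ` have the same finite models. -/
def FinEquivalent (Φ Ψ : L.Sentence) : Prop :=
  ∀ (A : Type) [Finite A] [Nonempty A] [L.Structure A], A ⊨ Φ ↔ A ⊨ Ψ

/-- The class of finite models of `Φ` is closed under isomorphic copies of substructures. -/
def FinClosedS (Φ : L.Sentence) : Prop :=
  ∀ (A B : Type) [Finite A] [Nonempty A] [Finite B] [Nonempty B]
    [L.Structure A] [L.Structure B], Nonempty (A ↪[L] B) → B ⊨ Φ → A ⊨ Φ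

/-- The class of finite models of `Φ` is closed under finitary direct products. -/
def FinClosedP (Φ : L.Sentence) : Prop :=
  ∀ (I : Type) [Finite I] (A : I → Type) [∀ i, Finite (A i)] [∀ i, Nonempty (A i)]
    [∀ i, L.Structure (A i)], (∀ i, A i ⊨ Φ) → (∀ i, A i) ⊨ Φ

/-- The class of finite models of `Φ` is closed under homomorphic images. -/
def FinClosedH (Φ : L.Sentence) : Prop :=
  ∀ (A B : Type) [Finite A] [Nonempty A] [Finite B] [Nonempty B]
    [L.Structure A] [L.Structure B] (f : A →[L] B), Function.Surjective f → A ⊨ Φ → B ⊨ Φ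

/-- The instance at `Φ` of the Łoś–Tarski theorem at the finite level. -/
def FinLosTarskiAt (Φ : L.Sentence) : Prop :=
  FinClosedS Φ → ∃ Ψ : L.Sentence, Ψ.IsUniversal ∧ FinEquivalent Φ Ψ

/-- The instance at `Φ` of the `SP`-preservation theorem at the finite level. -/
def FinSPPreservationAt (Φ : L.Sentence) : Prop :=
  FinClosedS Φ ∧ FinClosedP Φ → ∃ Ψ : L.Sentence, IsUniversalHorn Ψ ∧ FinEquivalent Φ Ψ

/-- The instance at `Φ` of the `HSP`-preservation theorem at the finite level. -/
def FinHSPPreservationAt (Φ : L.Sentence) : Prop :=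
  FinClosedH Φ ∧ FinClosedS Φ ∧ FinClosedP Φ →
    ∃ E : Finset (Equation L), ∀ (A : Type) [Finite A] [Nonempty A] [L.Structure A],
      A ⊨ Φ ↔ ∀ e ∈ E, SatisfiesEquation A e

end Preservation

/-! ### Flat extensions -/

/-- The symbols added in a flat extension: the constant `0` and the flat meet. -/
inductive FlatSymbol : ℕ → Type
  | zero : FlatSymbol 0
  | meet : FlatSymbol 2

/-- The operation symbols of `L` together with `0` and the flat meet. -/
def flatLanguage (L : FirstOrder.Language.{0, 0}) : FirstOrder.Language.{0, 0} where
  Functions n := L.Functions n ⊕ FlatSymbol n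
  Relations _ := Empty

/-- The universe of the flat extension of `A`: the elements of `A` together with a new
element `0`, namely `none`. -/
abbrev Flat (A : Type) : Type := Option A

open Classical in
/-- The flat extension with distinguished `0`: the operations of `A` are extended by making `0`
absorbing, and `x ∧ y` is `x` if `x = y` and `0` otherwise. -/
noncomputable instance flatStructure {L : FirstOrder.Language.{0, 0}} (A : Type) [L.Structure A] :
    (flatLanguage L).Structure (Flat A) where
  funMap := fun {_} f =>
    match f with
    | Sum.inl g => fun x =>
        if h : ∀ i, (x i).isSome then
          some (FirstOrder.Language.Structure.funMap g (fun i => (x i).get (h i)))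
        else none
    | Sum.inr FlatSymbol.zero => fun _ => none
    | Sum.inr FlatSymbol.meet => fun x => if x 0 = x 1 then x 0 else none
  RelMap := fun r _ => nomatch r

/-! ### Lattices as algebras -/

/-- The operation symbols of lattices. -/
inductive LatticeSymbol : ℕ → Type
  | inf : LatticeSymbol 2
  | sup : LatticeSymbol 2

/-- The signature of lattices. -/
def latticeLanguage : FirstOrder.Language.{0, 0} where
  Functions := LatticeSymbol
  Relations _ := Empty

/-- A lattice as an algebra with the operations meet and join. -/
instance latticeStructure (A : Type) [Lattice A] : latticeLanguage.Structure A where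
  funMap := fun {_} f =>
    match f with
    | LatticeSymbol.inf => fun x => x 0 ⊓ x 1
    | LatticeSymbol.sup => fun x => x 0 ⊔ x 1
  RelMap := fun r _ => nomatch r

/-- The underlying set of Belkin's 10-element modular lattice `M₃₋₃`: a lower copy
`l0 < la, lb, lc < l1` and an upper copy `u0 < ua, ub, uc < u1` of the lattice `M₃`. -/
inductive M33 : Type
  | l0 | la | lb | lc | l1 | u0 | ua | ub | uc | u1
  deriving DecidableEq

namespace M33

instance : Fintype M33 where
  elems := {l0, la, lb, lc, l1, u0, ua, ub, uc, u1}
  complete x := by cases x <;> decide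

/-- The elements above a given one: the two copies of `M₃` are linked by the coverings
`lc < u0` and `l1 < ua`. -/
def above : M33 → List M33
  | l0 => [l0, la, lb, lc, l1, u0, ua, ub, uc, u1]
  | la => [la, l1, ua, u1]
  | lb => [lb, l1, ua, u1]
  | lc => [lc, l1, u0, ua, ub, uc, u1]
  | l1 => [l1, ua, u1]
  | u0 => [u0, ua, ub, uc, u1]
  | ua => [ua, u1]
  | ub => [ub, u1]
  | uc => [uc, u1]
  | u1 => [u1]

instance : LE M33 := ⟨fun x y => y ∈ above x⟩

instance : DecidableLE M33 := fun x y => inferInstanceAs (Decidable (y ∈ above x))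

/-- The join in `M₃₋₃`. -/
def join (x y : M33) : M33 :=
  if x ≤ y then y else if y ≤ x then x
  else if x ≤ l1 ∧ y ≤ l1 then l1 else if x ≤ ua ∧ y ≤ ua then ua else u1

/-- The meet in `M₃₋₃`. -/
def meet (x y : M33) : M33 :=
  if x ≤ y then x else if y ≤ x then y
  else if u0 ≤ x ∧ u0 ≤ y then u0 else if lc ≤ x ∧ lc ≤ y then lc else l0

instance : Lattice M33 where
  le_refl := by decide
  le_trans := by decide
  le_antisymm := by decide
  sup := join
  inf := meet
  le_sup_left := by decide
  le_sup_right := by decide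
  sup_le := by decide
  inf_le_left := by decide
  inf_le_right := by decide
  le_inf := by decide

end M33

end FlatLattice

namespace FlatLattice

open FirstOrder.Language

/-! ### Terms, equations and Birkhoff's theorem -/

section General

variable {L : FirstOrder.Language.{0, 0}}

/-! Flat extensions turn quasi-identities into equations. On flat extensions a term is either
constantly 0 or a lattice term `u` restricted to the solutions of a finite system `C`
(`exists_flat_normalForm`). By idempotence a constant assignment solves every such system, so an
equation of `Flat A` amounts to finitely many quasi-identities of the lattice `A`. Conversely, `res
x y = (x ∨ y) ∧ x` is `x` if `y` is nonzero and 0 otherwise, which lets an equation carry premises.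
Hence `Flat D` lies in the variety of `Flat A` iff `D` satisfies the quasi-identities of `A`
(`memVariety_flat_iff`), and a finite equational basis yields a finite universal Horn basis. By
Birkhoff's theorem and compactness, a first order axiom for the variety would already give a finite
equational basis.

Finite members are first order definable for the following reason. In an algebra `S` satisfying the
finitely many `flatLaws`, the elements of one fixed nonzero support form a fibre, and the
projections to the flat extensions of these fibres separate the points of `S`. Membership in the
variety therefore follows once homomorphisms to `A` separate the points of each nonzero fibre. A
homomorphism from a finite fibre is recovered from the least elements of the preimages of the
principal filters of `A`, that is, from a family of elements indexed by `A`. So "for all `e, a, b`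
there is a code `p` such that for all `x, y` ..." is a first order condition
(`memVariety_of_fibersSeparated`, `fibersSeparated_of_memVariety`).

For `M33`, the `n`th Belkin lattice inserts a linear sum of `n` copies of `M₃` into the common edge
of two glued copies of `M₃`. A homomorphism to `M33` that does not collapse this edge must move from
`lc` to `u0` along the sum, but `lc` is not the bottom of a nontrivial diamond (`Belkin.hom_eq`). If
one copy keeps only its extreme elements, the move can be made there (`Belkin.quasi_part`). Any `N`
elements leave one of `N + 1` copies untouched, while a `∀*∃*` sentence only tests boundedly many
elements at a time (`IsForallExists.exists_bound`). So no finite set of such sentences detects the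
failure, neither for `M33` nor for its flat extension. -/

theorem realize_congr_of_varFinset {M α : Type} [L.Structure M] [DecidableEq α] {v w : α → M}
    (t : L.Term α) (h : ∀ k ∈ t.varFinset, v k = w k) : t.realize v = t.realize w := by
  induction t with
  | var k => exact h k (by simp [Term.varFinset])
  | func f ts ih =>
    simp only [Term.realize_func]
    congr 1
    funext i
    exact ih i fun k hk => h k (by
      simp only [Term.varFinset, Finset.mem_biUnion, Finset.mem_univ, true_and]
      exact ⟨i, hk⟩)

theorem realize_pi {I : Type} {A : I → Type} [∀ i, L.Structure (A i)] {α : Type}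
    (v : α → ∀ i, A i) (t : L.Term α) (i : I) :
    t.realize v i = t.realize (fun k => v k i) := by
  induction t with
  | var k => rfl
  | func f ts ih =>
    simp only [Term.realize_func]
    rw [← funext ih]
    rfl

theorem SatisfiesEquation.pi {I : Type} {A : I → Type} [∀ i, L.Structure (A i)]
    {e : Equation L} (h : ∀ i, SatisfiesEquation (A i) e) : SatisfiesEquation (∀ i, A i) e := by
  intro v
  funext i
  rw [realize_pi, realize_pi]
  exact h i _

theorem SatisfiesEquation.of_injective {A B : Type} [L.Structure A] [L.Structure B]
    {e : Equation L} (f : A →[L] B) (hf : Function.Injective f) (h : SatisfiesEquation B e) :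
    SatisfiesEquation A e := by
  intro v
  apply hf
  rw [← HomClass.realize_term, ← HomClass.realize_term]
  exact h _

theorem SatisfiesEquation.of_surjective {A B : Type} [L.Structure A] [L.Structure B]
    {e : Equation L} (f : A →[L] B) (hf : Function.Surjective f) (h : SatisfiesEquation A e) :
    SatisfiesEquation B e := by
  intro v
  obtain ⟨w, rfl⟩ : ∃ w : ℕ → A, f ∘ w = v :=
    ⟨fun k => (hf (v k)).choose, funext fun k => (hf (v k)).choose_spec⟩
  rw [HomClass.realize_term, HomClass.realize_term, h w]

/-- An identity of `B` in arbitrarily many variables is inherited by every algebra satisfying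
all equations of `B`. -/
theorem realize_eq_of_equations {B S : Type} [L.Structure B] [L.Structure S] [Nonempty S]
    (h : ∀ e : Equation L, SatisfiesEquation B e → SatisfiesEquation S e) (t s : L.Term S)
    (hts : ∀ i : S → B, t.realize i = s.realize i) :
    t.realize (id : S → S) = s.realize id := by
  classical
  -- Only finitely many elements of `S` occur as variables. Numbering them injectively gives an
  -- equation in variables from `ℕ`, which is then evaluated at the inverse numbering.
  obtain ⟨g, hg⟩ := Set.countable_iff_exists_injOn.1
    (t.varFinset ∪ s.varFinset).countable_toSet
  have hinv := hg.leftInvOn_invFunOn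
  have := h (t.relabel g, s.relabel g) (fun w => by simp [hts])
    (Function.invFunOn g (t.varFinset ∪ s.varFinset : Finset S))
  simp only [Term.realize_relabel] at this
  rw [realize_congr_of_varFinset t, realize_congr_of_varFinset s]
  · exact this
  · intro k hk
    exact (hinv (by simp [hk])).symm
  · intro k hk
    exact (hinv (by simp [hk])).symm

/-- Birkhoff's theorem: membership in the variety generated by `B` is satisfaction of the
equations of `B`. -/
theorem memVariety_iff [L.IsAlgebraic] {B S : Type} [L.Structure B] [L.Structure S]
    [Nonempty S] :
    MemVariety L B S ↔ ∀ e : Equation L, SatisfiesEquation B e → SatisfiesEquation S e := by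
  constructor
  · rintro ⟨I, T, f, hf⟩ e he
    exact ((SatisfiesEquation.pi (A := fun _ : I => B) fun _ => he).of_injective
      T.subtype.toHom Subtype.val_injective).of_surjective f hf
  · intro h
    -- The term functions form the free algebra on `S` in the variety of `B`; the homomorphism onto
    -- `S` evaluates a term at its own variables.
    let T : L.Substructure ((S → B) → B) :=
      { carrier := {x | ∃ t : L.Term S, x = fun i => t.realize i}
        fun_mem := fun {n} f xs hxs => by
          choose ts hts using hxs
          refine ⟨Term.func f ts, funext fun i => ?_⟩
          change Structure.funMap f (fun j => xs j i) = _
          simp [hts] }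
    have hT : ∀ x : T, ∃ t : L.Term S, x.1 = fun i => t.realize i := fun x => x.2
    choose tm htm using hT
    have key : ∀ (x : T) (t : L.Term S), (x.1 = fun i => t.realize i) →
        (tm x).realize (id : S → S) = t.realize id := fun x t hx =>
      realize_eq_of_equations h _ _ fun i => congrFun ((htm x).symm.trans hx) i
    refine ⟨S → B, T, ⟨fun x => (tm x).realize id, fun {n} f xs => ?_, fun {n} r => ?_⟩, ?_⟩
    · rw [key _ (Term.func f fun j => tm (xs j))]
      · rfl
      · funext i
        change Structure.funMap f (fun j => (xs j).1 i) = _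
        simp [htm]
    · exact isEmptyElim r
    · intro s
      exact ⟨⟨fun i => i s, Term.var s, rfl⟩, key _ (Term.var s) rfl⟩

/-! ### Horn sentences from pairs of terms -/

/-- The quasi-identity with premises `C` and conclusion `c` holds in `M`. -/
def SatisfiesQuasi (M : Type) [L.Structure M] (C : List (Equation L)) (c : Equation L) : Prop :=
  ∀ w : ℕ → M, (∀ d ∈ C, d.1.realize w = d.2.realize w) → c.1.realize w = c.2.realize w

theorem IsUniversalHorn.alls {n : ℕ} {φ : L.BoundedFormula Empty n} (h : IsUniversalHorn φ) :
    IsUniversalHorn φ.alls := by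
  induction n with
  | zero => exact h
  | succ n ih => exact ih h.all

theorem IsHornClause.isQF {n : ℕ} {φ : L.BoundedFormula Empty n} (h : IsHornClause φ) :
    φ.IsQF := by
  induction h with
  | atomic h => exact h.isQF
  | falsum => exact BoundedFormula.isQF_bot
  | imp h _ ih => exact h.isQF.imp ih

theorem IsHorn.isQF {n : ℕ} {φ : L.BoundedFormula Empty n} (h : IsHorn φ) : φ.IsQF := by
  induction h with
  | clause h => exact h.isQF
  | and _ _ h1 h2 => exact h1.inf h2

theorem IsUniversalHorn.isUniversal {n : ℕ} {φ : L.BoundedFormula Empty n}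
    (h : IsUniversalHorn φ) : φ.IsUniversal := by
  induction h with
  | of_isHorn h => exact h.isQF.isUniversal
  | all _ ih => exact ih.all

theorem isForallExists_of_isUniversal {n : ℕ} {φ : L.BoundedFormula Empty n}
    (h : φ.IsUniversal) : IsForallExists φ := by
  induction h with
  | of_isQF h => exact .of_isExistential h.isExistential
  | all _ ih => exact ih.all

/-- A term in the first `n + 1` variables, as a term in bound variables. -/
def boundTerm (n : ℕ) (t : L.Term ℕ) : L.Term (Empty ⊕ Fin (n + 1)) :=
  -- The index is reduced modulo `n + 1`, which changes nothing for variables `k ≤ n`.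
  t.relabel fun k => Sum.inr (Fin.ofNat (n + 1) k)

theorem realize_boundTerm {M : Type} [L.Structure M] {n : ℕ} {t : L.Term ℕ}
    (ht : ∀ k ∈ t.varFinset, k ≤ n) (w : ℕ → M) (u : Empty → M) :
    (boundTerm n t).realize (Sum.elim u fun i : Fin (n + 1) => w i) = t.realize w := by
  rw [boundTerm, Term.realize_relabel]
  apply realize_congr_of_varFinset
  intro k hk
  simp [Nat.mod_eq_of_lt (Nat.lt_succ_of_le (ht k hk))]

theorem exists_var_bound (C : List (Equation L)) :
    ∃ n : ℕ, ∀ d ∈ C, (∀ k ∈ d.1.varFinset, k ≤ n) ∧ ∀ k ∈ d.2.varFinset, k ≤ n := by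
  classical
  refine ⟨(C.toFinset.biUnion fun d => d.1.varFinset ∪ d.2.varFinset).sup id, fun d hd => ?_⟩
  have : ∀ k ∈ d.1.varFinset ∪ d.2.varFinset,
      k ≤ (C.toFinset.biUnion fun d => d.1.varFinset ∪ d.2.varFinset).sup id := fun k hk =>
    Finset.le_sup (f := id) (Finset.mem_biUnion.2 ⟨d, by simpa using hd, hk⟩)
  exact ⟨fun k hk => this k (Finset.mem_union_left _ hk),
    fun k hk => this k (Finset.mem_union_right _ hk)⟩

theorem exists_hornSentence (C : List (Equation L)) (c : Equation L) :
    ∃ ψ : L.Sentence, IsUniversalHorn ψ ∧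
      ∀ (M : Type) [L.Structure M], M ⊨ ψ ↔ SatisfiesQuasi M C c := by
  obtain ⟨n, hn⟩ := exists_var_bound (c :: C)
  let fm : Equation L → L.BoundedFormula Empty (n + 1) := fun d =>
    (boundTerm n d.1).bdEqual (boundTerm n d.2)
  have hcl : ∀ C : List (Equation L),
      IsHornClause ((C.map fm).foldr BoundedFormula.imp (fm c)) := by
    intro C
    induction C with
    | nil => exact .atomic (.equal _ _)
    | cons d C ih => exact .imp (.equal _ _) ih
  refine ⟨BoundedFormula.alls ((C.map fm).foldr BoundedFormula.imp (fm c)),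
    (IsUniversalHorn.of_isHorn (.clause (hcl C))).alls, fun M _ => ?_⟩
  have hfm : ∀ d ∈ c :: C, ∀ (w : ℕ → M) (u : Empty → M),
      (fm d).Realize u (fun i => w i) ↔ d.1.realize w = d.2.realize w := by
    intro d hd w u
    simp only [fm, BoundedFormula.realize_bdEqual, realize_boundTerm (hn d hd).1,
      realize_boundTerm (hn d hd).2]
  rw [Sentence.Realize, BoundedFormula.realize_alls]
  have hw : ∀ w : ℕ → M, BoundedFormula.Realize
      ((C.map fm).foldr BoundedFormula.imp (fm c)) default (fun i : Fin (n + 1) => w i) ↔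
      ((∀ d ∈ C, d.1.realize w = d.2.realize w) → c.1.realize w = c.2.realize w) := by
    intro w
    rw [BoundedFormula.realize_foldr_imp, hfm c (by simp)]
    refine imp_congr_left ?_
    simp only [List.mem_map, forall_exists_index, and_imp, forall_apply_eq_imp_iff₂]
    exact forall₂_congr fun d hd => hfm d (by simp [hd]) w _
  constructor
  · intro h w
    exact (hw w).1 (h _)
  · intro h xs
    have := (hw fun k => xs (Fin.ofNat (n + 1) k)).2 (h _)
    simpa using this

theorem exists_equationSentence (e : Equation L) :
    ∃ ψ : L.Sentence, IsUniversalHorn ψ ∧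
      ∀ (M : Type) [L.Structure M], M ⊨ ψ ↔ SatisfiesEquation M e := by
  obtain ⟨ψ, h, hψ⟩ := exists_hornSentence [] e
  exact ⟨ψ, h, fun M _ => by simp [hψ, SatisfiesQuasi, SatisfiesEquation]⟩

/-- A variety that is the class of models of a sentence is finitely based. -/
theorem VarietyFirstOrderAxiomatisable.finitelyBased [L.IsAlgebraic] {B : Type} [L.Structure B]
    (h : VarietyFirstOrderAxiomatisable L B) : VarietyFinitelyBased L B := by
  classical
  obtain ⟨Φ, hΦ⟩ := h
  choose σ _ hσ using exists_equationSentence (L := L)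
  -- By Birkhoff's theorem the equations of `B` entail `Φ`. Compactness leaves finitely many of
  -- them.
  let T : L.Theory := {ψ | ∃ e, SatisfiesEquation B e ∧ ψ = σ e}
  have hT : T ⊨ᵇ Φ := by
    rw [Theory.models_sentence_iff]
    intro M
    rw [hΦ, memVariety_iff]
    exact fun e he => (hσ e M).1 (Theory.realize_sentence_of_mem T ⟨e, he, rfl⟩)
  obtain ⟨T₀, hT₀, hΦ₀⟩ := Theory.models_iff_finset_models.1 hT
  have hT₀' : ∀ ψ : T₀, ∃ e, SatisfiesEquation B e ∧ ψ.1 = σ e := fun ψ => hT₀ ψ.2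
  choose eq heq using hT₀'
  refine ⟨Finset.univ.image eq, fun A _ _ => ⟨fun hA => ?_, fun hA e he => ?_⟩⟩
  · rw [← hΦ]
    have : A ⊨ (T₀ : L.Theory) := by
      refine (Theory.model_iff _).2 fun ψ hψ => ?_
      have hψ' : ψ = σ _ := (heq ⟨ψ, hψ⟩).2
      rw [hψ', hσ]
      exact hA _ (Finset.mem_image_of_mem _ (Finset.mem_univ _))
    exact hΦ₀.realize_sentence A
  · obtain ⟨ψ, _, rfl⟩ := Finset.mem_image.1 he
    exact memVariety_iff.1 hA _ (heq ψ).1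

/-! ### Local character of `∀*∃*` sentences -/

/-- Validity of a `∀*∃*` formula may be tested on substructures containing any prescribed
`N` elements. -/
theorem IsForallExists.exists_bound {n : ℕ} {φ : L.BoundedFormula Empty n}
    (h : IsForallExists φ) :
    ∃ N : ℕ, ∀ (M : Type) [L.Structure M] (xs : Fin n → M),
      (∀ Y : Finset M, Y.card ≤ N → ∃ (S : Type) (_ : L.Structure S) (g : S ↪[L] M)
        (xs' : Fin n → S), g ∘ xs' = xs ∧ (∀ y ∈ Y, y ∈ Set.range g) ∧ φ.Realize default xs') →
      φ.Realize default xs := by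
  classical
  induction h with
  | of_isExistential h =>
    -- Existential formulas pass from a substructure to the whole, so no elements need to be
    -- prescribed.
    refine ⟨0, fun M _ xs hM => ?_⟩
    obtain ⟨S, _, g, xs', rfl, -, hφ⟩ := hM ∅ (by simp)
    have := h.realize_embedding g hφ
    rwa [Subsingleton.elim (g ∘ default) default] at this
  | all h ih =>
    obtain ⟨N, hN⟩ := ih
    -- The extra element is the instance `a` of the leading quantifier, so `N` counts the universal
    -- quantifiers of the prefix.
    refine ⟨N + 1, fun M _ xs hM a => hN M _ fun Y hY => ?_⟩
    obtain ⟨S, iS, g, xs', rfl, hg, hφ⟩ := hM (insert a Y)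
      ((Finset.card_insert_le _ _).trans (by omega))
    obtain ⟨a', rfl⟩ := hg a (by simp)
    exact ⟨S, iS, g, Fin.snoc xs' a', by rw [Fin.comp_snoc],
      fun y hy => hg y (by simp [hy]), hφ a'⟩

theorem exists_bound_of_isForallExists {φ : L.Sentence} (h : IsForallExists φ) :
    ∃ N : ℕ, ∀ (M : Type) [L.Structure M],
      (∀ Y : Finset M, Y.card ≤ N → ∃ (S : Type) (_ : L.Structure S) (g : S ↪[L] M),
        (∀ y ∈ Y, y ∈ Set.range g) ∧ S ⊨ φ) → M ⊨ φ := by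
  obtain ⟨N, hN⟩ := h.exists_bound
  refine ⟨N, fun M _ hM => hN M default fun Y hY => ?_⟩
  obtain ⟨S, iS, g, hg, hφ⟩ := hM Y hY
  exact ⟨S, iS, g, default, Subsingleton.elim _ _, hg, hφ⟩

theorem exists_bound_of_finset {Γ : Finset L.Sentence} (h : ∀ φ ∈ Γ, IsForallExists φ) :
    ∃ N : ℕ, ∀ (M : Type) [L.Structure M],
      (∀ Y : Finset M, Y.card ≤ N → ∃ (S : Type) (_ : L.Structure S) (g : S ↪[L] M),
        (∀ y ∈ Y, y ∈ Set.range g) ∧ ∀ φ ∈ Γ, S ⊨ φ) → ∀ φ ∈ Γ, M ⊨ φ := by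
  choose N hN using fun φ : Γ => exists_bound_of_isForallExists (h φ.1 φ.2)
  refine ⟨Finset.univ.sup N, fun M _ hM φ hφ => hN ⟨φ, hφ⟩ M fun Y hY => ?_⟩
  obtain ⟨S, iS, g, hg, hS⟩ := hM Y (hY.trans (Finset.le_sup (Finset.mem_univ _)))
  exact ⟨S, iS, g, hg, hS φ hφ⟩

end General

/-! ### Definable properties of assignments -/

section Definable

variable {L : FirstOrder.Language.{0, 0}}

/-- The property `Q` of the first `n` entries of an assignment is uniformly definable by a formula
of the class `P`. -/
def DefinableBy (P : ∀ {n : ℕ}, L.BoundedFormula Empty n → Prop) (n : ℕ)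
    (Q : ∀ (S : Type) [L.Structure S], (ℕ → S) → Prop) : Prop :=
  ∃ φ : L.BoundedFormula Empty n, P φ ∧
    ∀ (S : Type) [L.Structure S] (v : ℕ → S),
      φ.Realize default (fun i : Fin n => v i) ↔ Q S v

/-- Quantifier-free definability. -/
abbrev QFDef (n : ℕ) (Q : ∀ (S : Type) [L.Structure S], (ℕ → S) → Prop) : Prop :=
  DefinableBy (L := L) (fun φ => φ.IsQF) n Q

theorem QFDef.equation {n : ℕ} (t s : L.Term ℕ) (ht : ∀ k ∈ t.varFinset, k ≤ n)
    (hs : ∀ k ∈ s.varFinset, k ≤ n) :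
    QFDef (L := L) (n + 1) (fun _ _ v => t.realize v = s.realize v) :=
  ⟨(boundTerm n t).bdEqual (boundTerm n s), (BoundedFormula.IsAtomic.equal _ _).isQF,
    fun S _ v => by
      rw [BoundedFormula.realize_bdEqual, realize_boundTerm ht, realize_boundTerm hs]⟩

theorem QFDef.imp {n : ℕ} {Q R : ∀ (S : Type) [L.Structure S], (ℕ → S) → Prop}
    (hQ : QFDef n Q) (hR : QFDef n R) : QFDef (L := L) n (fun S _ v => Q S v → R S v) := by
  obtain ⟨φ, h, hφ⟩ := hQ
  obtain ⟨ψ, h', hψ⟩ := hR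
  exact ⟨φ.imp ψ, h.imp h', fun S _ v => by simp [hφ, hψ]⟩

theorem QFDef.and {n : ℕ} {Q R : ∀ (S : Type) [L.Structure S], (ℕ → S) → Prop}
    (hQ : QFDef n Q) (hR : QFDef n R) : QFDef (L := L) n (fun S _ v => Q S v ∧ R S v) := by
  obtain ⟨φ, h, hφ⟩ := hQ
  obtain ⟨ψ, h', hψ⟩ := hR
  exact ⟨φ ⊓ ψ, h.inf h', fun S _ v => by simp [hφ, hψ]⟩

theorem QFDef.false (n : ℕ) : QFDef (L := L) n (fun _ _ _ => False) :=
  ⟨⊥, BoundedFormula.isQF_bot, fun S _ v => by simp⟩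

theorem QFDef.not {n : ℕ} {Q : ∀ (S : Type) [L.Structure S], (ℕ → S) → Prop}
    (hQ : QFDef n Q) : QFDef (L := L) n (fun S _ v => ¬ Q S v) :=
  hQ.imp (QFDef.false n)

theorem QFDef.const (n : ℕ) (p : Prop) : QFDef (L := L) n (fun _ _ _ => p) := by
  by_cases hp : p
  · simpa [hp] using (QFDef.false (L := L) n).not
  · simpa [hp] using QFDef.false (L := L) n

theorem QFDef.iff {n : ℕ} {Q R : ∀ (S : Type) [L.Structure S], (ℕ → S) → Prop}
    (hQ : QFDef n Q) (hR : QFDef n R) : QFDef (L := L) n (fun S _ v => Q S v ↔ R S v) := by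
  simpa only [iff_iff_implies_and_implies] using (hQ.imp hR).and (hR.imp hQ)

theorem QFDef.forall_mem_list {n : ℕ} {ι : Type}
    {Q : ι → ∀ (S : Type) [L.Structure S], (ℕ → S) → Prop} (l : List ι)
    (h : ∀ i ∈ l, QFDef n (Q i)) : QFDef (L := L) n (fun S _ v => ∀ i ∈ l, Q i S v) := by
  induction l with
  | nil => simpa using (QFDef.false (L := L) n).not
  | cons i l ih =>
    simpa using (h i (by simp)).and (ih fun j hj => h j (by simp [hj]))

theorem QFDef.forall {n : ℕ} {ι : Type} [Finite ι]
    {Q : ι → ∀ (S : Type) [L.Structure S], (ℕ → S) → Prop} (h : ∀ i, QFDef n (Q i)) :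
    QFDef (L := L) n (fun S _ v => ∀ i, Q i S v) := by
  obtain ⟨s, hs⟩ := Finite.exists_univ_list ι
  simpa [hs.2] using QFDef.forall_mem_list s fun i _ => h i

theorem QFDef.exists {n : ℕ} {ι : Type} [Finite ι]
    {Q : ι → ∀ (S : Type) [L.Structure S], (ℕ → S) → Prop} (h : ∀ i, QFDef n (Q i)) :
    QFDef (L := L) n (fun S _ v => ∃ i, Q i S v) := by
  simpa using (QFDef.forall fun i => (h i).not).not

variable {P : ∀ {n : ℕ}, L.BoundedFormula Empty n → Prop}

theorem snoc_eq_update {S : Type} (v : ℕ → S) (n : ℕ) (a : S) :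
    Fin.snoc (α := fun _ => S) (fun i : Fin n => v i) a =
      fun i : Fin (n + 1) => Function.update v n a (i : ℕ) := by
  funext i
  refine Fin.lastCases ?_ (fun i => ?_) i
  · simp
  · simp [Function.update_of_ne i.2.ne]

theorem update_agree {S : Type} {n m : ℕ} {v v' : ℕ → S} {a : S}
    (h : ∀ k < n, v' k = v k) : ∀ k < n, Function.update v' (n + m) a k = v k := fun k hk => by
  rw [Function.update_of_ne (by omega), h k hk]

/-- Definability of the universal quantification over the entries `n, …, n + m - 1`. -/
theorem DefinableBy.all (hP : ∀ {n : ℕ} {φ : L.BoundedFormula Empty (n + 1)}, P φ → P φ.all)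
    {n : ℕ} (m : ℕ) {Q : ∀ (S : Type) [L.Structure S], (ℕ → S) → Prop}
    (hQ : DefinableBy P (n + m) Q) :
    DefinableBy P n (fun S _ v => ∀ v' : ℕ → S, (∀ k < n, v' k = v k) → Q S v') := by
  induction m generalizing Q with
  | zero =>
    obtain ⟨φ, h, hφ⟩ := hQ
    refine ⟨φ, h, fun S _ v => ⟨fun H v' hv' => ?_, fun H => (hφ S v).2 (H v fun _ _ => rfl)⟩⟩
    have e : (fun i : Fin (n + 0) => v' i) = fun i : Fin (n + 0) => v i :=
      funext fun i => hv' i i.2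
    rw [← hφ S v', e]
    exact H
  | succ m ih =>
    obtain ⟨φ, h, hφ⟩ := hQ
    obtain ⟨ψ, h', hψ⟩ := ih (Q := fun S _ v => ∀ a, Q S (Function.update v (n + m) a))
      ⟨φ.all, hP h, fun S _ v => by
        simp only [BoundedFormula.realize_all, snoc_eq_update]
        exact forall_congr' fun a => hφ S _⟩
    refine ⟨ψ, h', fun S _ v => (hψ S v).trans ⟨fun H v' hv' => ?_, fun H v' hv' a =>
      H _ (update_agree hv')⟩⟩
    simpa using H v' hv' (v' (n + m))

/-- Definability of the existential quantification over the entries `n, …, n + m - 1`. -/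
theorem DefinableBy.ex (hP : ∀ {n : ℕ} {φ : L.BoundedFormula Empty (n + 1)}, P φ → P φ.ex)
    {n : ℕ} (m : ℕ) {Q : ∀ (S : Type) [L.Structure S], (ℕ → S) → Prop}
    (hQ : DefinableBy P (n + m) Q) :
    DefinableBy P n (fun S _ v => ∃ v' : ℕ → S, (∀ k < n, v' k = v k) ∧ Q S v') := by
  induction m generalizing Q with
  | zero =>
    obtain ⟨φ, h, hφ⟩ := hQ
    refine ⟨φ, h, fun S _ v => ⟨fun H => ⟨v, fun _ _ => rfl, (hφ S v).1 H⟩, ?_⟩⟩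
    rintro ⟨v', hv', H⟩
    have e : (fun i : Fin (n + 0) => v' i) = fun i : Fin (n + 0) => v i :=
      funext fun i => hv' i i.2
    rw [← hφ S v', e] at H
    exact H
  | succ m ih =>
    obtain ⟨φ, h, hφ⟩ := hQ
    obtain ⟨ψ, h', hψ⟩ := ih (Q := fun S _ v => ∃ a, Q S (Function.update v (n + m) a))
      ⟨φ.ex, hP h, fun S _ v => by
        simp only [BoundedFormula.realize_ex, snoc_eq_update]
        exact exists_congr fun a => hφ S _⟩
    refine ⟨ψ, h', fun S _ v => (hψ S v).trans ⟨?_, ?_⟩⟩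
    · rintro ⟨v', hv', a, ha⟩
      exact ⟨_, update_agree hv', ha⟩
    · rintro ⟨v', hv', H⟩
      exact ⟨v', hv', v' (n + m), by simpa using H⟩

/-- A quantifier block is expressed by passing to an assignment that agrees with the previous one on
all earlier entries. Nonemptiness supplies an assignment at which the sentence can be evaluated. -/
theorem QFDef.forall_exists_forall (n m l : ℕ)
    {Q : ∀ (S : Type) [L.Structure S], (ℕ → S) → Prop} (hQ : QFDef (n + m + l) Q) :
    ∃ Φ : L.Sentence, IsForallExistsForall Φ ∧ ∀ (S : Type) [L.Structure S] [Nonempty S],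
      S ⊨ Φ ↔ ∀ v : ℕ → S, ∃ v' : ℕ → S, (∀ k < n, v' k = v k) ∧
        ∀ v'' : ℕ → S, (∀ k < n + m, v'' k = v' k) → Q S v'' := by
  have h1' : DefinableBy (L := L) (fun φ => φ.IsUniversal) (n + m + l) Q := by
    obtain ⟨φ, h, hφ⟩ := hQ
    exact ⟨φ, h.isUniversal, hφ⟩
  obtain ⟨φ, h, hφ⟩ := h1'.all (fun h => h.all) l
  obtain ⟨φ', h', hφ'⟩ := DefinableBy.ex (P := IsExistsForall) (fun h => h.ex) m
    ⟨φ, .of_isUniversal h, hφ⟩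
  obtain ⟨Φ, hΦ, H⟩ := DefinableBy.all (P := IsForallExistsForall) (fun h => h.all) (n := 0) n
    (Q := fun S _ v => ∃ v' : ℕ → S, (∀ k < n, v' k = v k) ∧
      ∀ v'' : ℕ → S, (∀ k < n + m, v'' k = v' k) → Q S v'')
    (by rw [Nat.zero_add]; exact ⟨φ', .of_isExistsForall h', hφ'⟩)
  refine ⟨Φ, hΦ, fun S _ _ => ?_⟩
  obtain ⟨s⟩ := ‹Nonempty S›
  have := H S fun _ => s
  rw [Subsingleton.elim (fun i : Fin 0 => s) default] at this
  exact this.trans (by simp)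

end Definable

/-! ### Evaluation in flat extensions -/

section Flat

variable {L : FirstOrder.Language.{0, 0}}

instance : (flatLanguage L).IsAlgebraic := fun _ => inferInstanceAs (IsEmpty Empty)

instance : latticeLanguage.IsAlgebraic := fun _ => inferInstanceAs (IsEmpty Empty)

/-- An operation symbol of `L` as a symbol of the flat signature. -/
def origSymbol {n : ℕ} (g : L.Functions n) : (flatLanguage L).Functions n := Sum.inl g

/-- The constant symbol `0`. -/
def zeroSymbol : (flatLanguage L).Functions 0 := Sum.inr FlatSymbol.zero

/-- The symbol of the flat meet. -/
def meetSymbol : (flatLanguage L).Functions 2 := Sum.inr FlatSymbol.meet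

theorem flatTerm_induction {α : Type} {motive : (flatLanguage L).Term α → Prop}
    (var : ∀ k, motive (.var k))
    (orig : ∀ (n : ℕ) (g : L.Functions n) (ts : Fin n → (flatLanguage L).Term α),
      (∀ i, motive (ts i)) → motive (.func (origSymbol g) ts))
    (zero : ∀ ts : Fin 0 → (flatLanguage L).Term α, motive (.func zeroSymbol ts))
    (meet : ∀ ts : Fin 2 → (flatLanguage L).Term α, (∀ i, motive (ts i)) →
      motive (.func meetSymbol ts)) (t : (flatLanguage L).Term α) : motive t := by
  induction t with
  | var k => exact var k
  | func f ts ih =>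
    rcases f with g | g
    · exact orig _ g ts ih
    · rcases g with _ | _
      · exact zero ts
      · exact meet ts ih

theorem flat_funMap_none {D : Type} [L.Structure D] {n : ℕ} (g : L.Functions n)
    {x : Fin n → Flat D} {i : Fin n} (h : x i = none) :
    Structure.funMap (origSymbol g) x = none := by
  refine dif_neg fun h' => ?_
  simpa [h] using h' i

theorem flat_funMap_some {D : Type} [L.Structure D] {n : ℕ} (g : L.Functions n)
    (y : Fin n → D) :
    Structure.funMap (origSymbol g) (fun i => (some (y i) : Flat D)) = some (Structure.funMap g y) :=
  dif_pos fun _ => rfl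

theorem flat_funMap_meet_eq {D : Type} [L.Structure D] {x : Fin 2 → Flat D} (h : x 0 = x 1) :
    Structure.funMap (meetSymbol (L := L)) x =
      x 0 :=
  if_pos h

theorem flat_funMap_meet_ne {D : Type} [L.Structure D] {x : Fin 2 → Flat D} (h : x 0 ≠ x 1) :
    Structure.funMap (meetSymbol (L := L)) x =
      none :=
  if_neg h

/-- Every term of the flat signature is constantly `0` or given, on flat extensions, by a term of
the original signature, on the solution set of finitely many equations. -/
theorem exists_flat_normalForm (t : (flatLanguage L).Term ℕ) :
    (∀ (D : Type) [L.Structure D] (v : ℕ → Flat D), t.realize v = none) ∨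
    ∃ (C : List (Equation L)) (u : L.Term ℕ) (X : Set ℕ),
      ∀ (D : Type) [L.Structure D] (v : ℕ → Flat D),
        (∀ k ∈ X, v k = none → t.realize v = none) ∧
        ∀ w : ℕ → D, (∀ k ∈ X, v k = some (w k)) →
          ((∀ d ∈ C, d.1.realize w = d.2.realize w) → t.realize v = some (u.realize w)) ∧
          ((¬ ∀ d ∈ C, d.1.realize w = d.2.realize w) → t.realize v = none) := by
  induction t using flatTerm_induction with
  | var k =>
    refine Or.inr ⟨[], Term.var k, {k}, fun D _ v => ⟨?_, fun w hw => ⟨fun _ => ?_, ?_⟩⟩⟩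
    · rintro _ rfl h
      exact h
    · exact hw k rfl
    · simp
  | orig n g ts ih =>
    by_cases h0 : ∃ i, ∀ (D : Type) [L.Structure D] (v : ℕ → Flat D),
        (ts i).realize v = none
    · obtain ⟨i, hi⟩ := h0
      exact Or.inl fun D _ v => flat_funMap_none g (i := i) (hi D v)
    · push Not at h0
      have ih' := fun i => (ih i).resolve_left (by
        obtain ⟨D, iD, v, hv⟩ := h0 i
        exact fun h => hv (h D v))
      choose C u X H using ih'
      refine Or.inr ⟨(List.finRange n).flatMap C, Term.func g u, ⋃ i, X i, fun D _ v =>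
        ⟨fun k hk hv => ?_, fun w hw => ⟨fun hC => ?_, fun hC => ?_⟩⟩⟩
      · obtain ⟨i, hi⟩ := Set.mem_iUnion.1 hk
        exact flat_funMap_none g (i := i) ((H i D v).1 k hi hv)
      · rw [Term.realize_func, Term.realize_func, ← flat_funMap_some]
        congr 1
        funext i
        exact (((H i D v).2 w) fun k hk => hw k (Set.mem_iUnion.2 ⟨i, hk⟩)).1
          fun d hd => hC d (List.mem_flatMap.2 ⟨i, List.mem_finRange i, hd⟩)
      · obtain ⟨i, hi⟩ : ∃ i, ¬ ∀ d ∈ C i, d.1.realize w = d.2.realize w := by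
          by_contra! hcon
          refine hC fun d hd => ?_
          obtain ⟨i, -, hi⟩ := List.mem_flatMap.1 hd
          exact hcon i d hi
        exact flat_funMap_none g (i := i)
          ((((H i D v).2 w) fun k hk => hw k (Set.mem_iUnion.2 ⟨i, hk⟩)).2 hi)
  | zero ts => exact Or.inl fun D _ v => rfl
  | meet ts ih =>
    have hnone : ∀ i, (∀ (D : Type) [L.Structure D] (v : ℕ → Flat D),
        (ts i).realize v = none) → ∀ (D : Type) [L.Structure D] (v : ℕ → Flat D),
        (Term.func (meetSymbol (L := L)) ts).realize v = none := by
      intro i hi D _ v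
      rw [Term.realize_func]
      by_cases h : (ts 0).realize v = (ts 1).realize v
      · rw [flat_funMap_meet_eq h]
        fin_cases i
        · exact hi D v
        · exact h.trans (hi D v)
      · exact flat_funMap_meet_ne h
    rcases ih 0 with h | ⟨C, u, X, H⟩
    · exact Or.inl (hnone 0 h)
    rcases ih 1 with h | ⟨C', u', X', H'⟩
    · exact Or.inl (hnone 1 h)
    -- A flat meet is nonzero only where its arguments agree, so it contributes the condition `u =
    -- u'`; on these solutions either of `u`, `u'` gives the value.
    refine Or.inr ⟨(u, u') :: (C ++ C'), u, X ∪ X', fun D _ v => ⟨fun k hk hv => ?_,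
      fun w hw => ?_⟩⟩
    · rw [Term.realize_func]
      by_cases h : (ts 0).realize v = (ts 1).realize v
      · rw [flat_funMap_meet_eq h]
        rcases hk with hk | hk
        · exact (H D v).1 k hk hv
        · exact h.trans ((H' D v).1 k hk hv)
      · exact flat_funMap_meet_ne h
    · have h1 := (H D v).2 w fun k hk => hw k (Or.inl hk)
      have h2 := (H' D v).2 w fun k hk => hw k (Or.inr hk)
      rw [List.forall_mem_cons, List.forall_mem_append]
      rw [Term.realize_func]
      by_cases hC : ∀ d ∈ C, d.1.realize w = d.2.realize w
      · by_cases hC' : ∀ d ∈ C', d.1.realize w = d.2.realize w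
        · have e1 := h1.1 hC
          have e2 := h2.1 hC'
          refine ⟨fun hu => ?_, fun hu => ?_⟩
          · rw [flat_funMap_meet_eq (by rw [e1, e2, hu.1]), e1]
          · refine flat_funMap_meet_ne fun h => hu ⟨?_, hC, hC'⟩
            rw [e1, e2] at h
            exact Option.some_injective _ h
        · refine ⟨fun hu => absurd hu.2.2 hC', fun _ => ?_⟩
          by_cases h : (ts 0).realize v = (ts 1).realize v
          · rw [flat_funMap_meet_eq h]
            exact h.trans (h2.2 hC')
          · exact flat_funMap_meet_ne h
      · refine ⟨fun hu => absurd hu.2.1 hC, fun _ => ?_⟩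
        by_cases h : (ts 0).realize v = (ts 1).realize v
        · rw [flat_funMap_meet_eq h]
          exact h1.2 hC
        · exact flat_funMap_meet_ne h

/-- A term of the original signature, read in the flat signature. -/
def liftTerm {α : Type} : L.Term α → (flatLanguage L).Term α
  | .var k => .var k
  | .func f ts => .func (origSymbol f) fun i => liftTerm (ts i)

theorem realize_liftTerm_some {α D : Type} [L.Structure D] (t : L.Term α) (w : α → D) :
    (liftTerm t).realize (fun k => (some (w k) : Flat D)) = some (t.realize w) := by
  induction t with
  | var k => rfl
  | func f ts ih =>
    rw [liftTerm, Term.realize_func, Term.realize_func, ← flat_funMap_some]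
    exact congrArg _ (funext ih)

/-- A term is 0 as soon as one of its variables is, so the values of `w` at such variables may be
chosen arbitrarily. -/
theorem realize_liftTerm_cases {α D : Type} [L.Structure D] (t : L.Term α) {v : α → Flat D}
    {w : α → D} (h : ∀ k, v k = none ∨ v k = some (w k)) :
    (liftTerm t).realize v = none ∨ (liftTerm t).realize v = some (t.realize w) := by
  induction t with
  | var k => exact h k
  | func f ts ih =>
    rw [liftTerm, Term.realize_func, Term.realize_func]
    by_cases hn : ∃ i, (liftTerm (ts i)).realize v = none
    · obtain ⟨i, hi⟩ := hn
      exact Or.inl (flat_funMap_none f hi)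
    · push Not at hn
      right
      rw [← flat_funMap_some]
      exact congrArg _ (funext fun i => (ih i).resolve_left (hn i))

end Flat

/-! ### The lattice signature -/

section Lattice

/-- The signature of flat extensions of lattices. -/
abbrev flatLat : FirstOrder.Language.{0, 0} := flatLanguage latticeLanguage

/-- The symbol of the lattice meet. -/
def infSymbol : latticeLanguage.Functions 2 := LatticeSymbol.inf

/-- The symbol of the lattice join. -/
def supSymbol : latticeLanguage.Functions 2 := LatticeSymbol.sup

theorem latticeTerm_induction {α : Type} {motive : latticeLanguage.Term α → Prop}
    (var : ∀ k, motive (.var k))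
    (inf : ∀ ts : Fin 2 → latticeLanguage.Term α, (∀ i, motive (ts i)) →
      motive (.func infSymbol ts))
    (sup : ∀ ts : Fin 2 → latticeLanguage.Term α, (∀ i, motive (ts i)) →
      motive (.func supSymbol ts)) (t : latticeLanguage.Term α) : motive t := by
  induction t with
  | var k => exact var k
  | func f ts ih =>
    cases f
    · exact inf ts ih
    · exact sup ts ih

/-- Elements of a lattice are one-element subalgebras. Hence every system of lattice equations is
solvable in `A`, which excludes degenerate normal forms and purely negative Horn clauses. -/
theorem realize_const {A : Type} [Lattice A] {α : Type} (t : latticeLanguage.Term α) (a : A) :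
    t.realize (fun _ => a) = a := by
  induction t using latticeTerm_induction with
  | var k => rfl
  | inf ts ih =>
    rw [Term.realize_func, funext ih]
    exact inf_idem a
  | sup ts ih =>
    rw [Term.realize_func, funext ih]
    exact sup_idem a

/-- An equation of the flat extension of a lattice `A` follows, in all flat extensions,
from finitely many quasi-identities of `A`. -/
theorem exists_quasi_of_flat_equation {A : Type} [Lattice A] [Nonempty A]
    {e : Equation flatLat} (he : SatisfiesEquation (Flat A) e) :
    ∃ T : List (List (Equation latticeLanguage) × Equation latticeLanguage),
      (∀ p ∈ T, SatisfiesQuasi A p.1 p.2) ∧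
      ∀ (D : Type) [latticeLanguage.Structure D], (∀ p ∈ T, SatisfiesQuasi D p.1 p.2) →
        SatisfiesEquation (Flat D) e := by
  obtain ⟨t, s⟩ := e
  obtain ⟨a⟩ := ‹Nonempty A›
  have hconst : ∀ C : List (Equation latticeLanguage), ∀ d ∈ C,
      d.1.realize (fun _ => a) = d.2.realize (fun _ => a) := fun C d _ => by
    simp [realize_const]
  rcases exists_flat_normalForm t with h | ⟨C, u, X, H⟩
  · rcases exists_flat_normalForm s with h' | ⟨C', u', X', H'⟩
    · exact ⟨[], by simp, fun D _ _ v => (h D v).trans (h' D v).symm⟩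
    · have h1 := he fun _ => some a
      have h2 := (((H' A fun _ => some a).2 (fun _ => a) fun _ _ => rfl).1 (hconst C'))
      rw [h A, h2] at h1
      cases h1
  rcases exists_flat_normalForm s with h' | ⟨C', u', X', H'⟩
  · have h1 := he fun _ => some a
    have h2 := (((H A fun _ => some a).2 (fun _ => a) fun _ _ => rfl).1 (hconst C))
    rw [h' A, h2] at h1
    cases h1
  -- Put 0 at a variable occurring on one side only and a constant `a` elsewhere: one side becomes 0
  -- and the other `a`.
  have hX : X = X' := by
    classical
    ext k
    by_contra hk
    have hv := he (Function.update (fun _ => some a) k none)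
    by_cases hkX : k ∈ X
    · have hkX' : k ∉ X' := fun h => hk (by simp [hkX, h])
      have h1 := (H A _).1 k hkX (Function.update_self k none (fun _ => some a))
      have h2 := ((H' A (Function.update (fun _ => some a) k none)).2 (fun _ => a)
        fun j hj => Function.update_of_ne (by rintro rfl; exact hkX' hj) _ _).1 (hconst C')
      rw [h1, h2] at hv
      cases hv
    · have hkX' : k ∈ X' := by
        by_contra h
        exact hk (by simp [hkX, h])
      have h1 := (H' A _).1 k hkX' (Function.update_self k none (fun _ => some a))
      have h2 := ((H A (Function.update (fun _ => some a) k none)).2 (fun _ => a)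
        fun j hj => Function.update_of_ne (by rintro rfl; exact hkX hj) _ _).1 (hconst C)
      rw [h1, h2] at hv
      cases hv
  subst hX
  -- The equation says that `C` and `C'` have the same solutions and that `u = u'` on them; written
  -- as quasi-identities, these are `C → u = u'`, `C → C'` and `C' → C`.
  refine ⟨(C, (u, u')) :: (C'.map fun c => (C, c)) ++ (C.map fun c => (C', c)), ?_, ?_⟩
  · have key : ∀ w : ℕ → A,
        ((∀ d ∈ C, d.1.realize w = d.2.realize w) ↔ ∀ d ∈ C', d.1.realize w = d.2.realize w) ∧
        ((∀ d ∈ C, d.1.realize w = d.2.realize w) → u.realize w = u'.realize w) := by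
      intro w
      have h1 := (H A fun k => some (w k)).2 w fun _ _ => rfl
      have h2 := (H' A fun k => some (w k)).2 w fun _ _ => rfl
      have h3 := he fun k => some (w k)
      by_cases hC : ∀ d ∈ C, d.1.realize w = d.2.realize w
      · have hC' : ∀ d ∈ C', d.1.realize w = d.2.realize w := by
          by_contra hC'
          rw [h1.1 hC, h2.2 hC'] at h3
          cases h3
        refine ⟨⟨fun _ => hC', fun _ => hC⟩, fun _ => ?_⟩
        rw [h1.1 hC, h2.1 hC'] at h3
        exact Option.some_injective _ h3
      · refine ⟨⟨fun h => absurd h hC, fun hC' => ?_⟩, fun h => absurd h hC⟩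
        rw [h1.2 hC, h2.1 hC'] at h3
        cases h3
    intro p hp
    simp only [List.cons_append, List.mem_cons, List.mem_append, List.mem_map] at hp
    rcases hp with rfl | ⟨c, hc, rfl⟩ | ⟨c, hc, rfl⟩
    · exact fun w => (key w).2
    · exact fun w hw => (key w).1.1 hw c hc
    · exact fun w hw => (key w).1.2 hw c hc
  · intro D _ hD v
    by_cases hv : ∃ k ∈ X, v k = none
    · obtain ⟨k, hk, hv⟩ := hv
      exact ((H D v).1 k hk hv).trans ((H' D v).1 k hk hv).symm
    · push Not at hv
      by_cases hne : Nonempty D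
      · obtain ⟨d₀⟩ := hne
        have hw : ∀ k ∈ X, v k = some ((v k).getD d₀) := fun k hk => by
          obtain ⟨d, hd⟩ := Option.ne_none_iff_exists'.1 (hv k hk)
          simp [hd]
        have h1 := (H D v).2 (fun k => (v k).getD d₀) hw
        have h2 := (H' D v).2 (fun k => (v k).getD d₀) hw
        by_cases hC : ∀ d ∈ C, d.1.realize (fun k => (v k).getD d₀) =
            d.2.realize (fun k => (v k).getD d₀)
        · refine (h1.1 hC).trans ((congrArg some ?_).trans (h2.1 fun c hc => ?_).symm)
          · exact hD (C, (u, u')) (by simp) _ hC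
          · exact hD (C, c) (by simp [hc]) _ hC
        · refine (h1.2 hC).trans (h2.2 fun hC' => hC fun c hc => ?_).symm
          exact hD (C', c) (by simp [hc]) _ hC'
      · have : Subsingleton (Flat D) := ⟨fun x y => by
          cases x with
          | none => cases y with
            | none => rfl
            | some y => exact absurd ⟨y⟩ hne
          | some x => exact absurd ⟨x⟩ hne⟩
        exact Subsingleton.elim _ _

/-- If `D` satisfies the quasi-identities of the lattice `A`, then the flat extension of `D`
satisfies the equations of the flat extension of `A`. -/
theorem flat_equations_of_quasi {A D : Type} [Lattice A] [Nonempty A]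
    [latticeLanguage.Structure D]
    (h : ∀ C c, SatisfiesQuasi (L := latticeLanguage) A C c → SatisfiesQuasi D C c)
    (e : Equation flatLat) (he : SatisfiesEquation (Flat A) e) : SatisfiesEquation (Flat D) e := by
  obtain ⟨T, hT, H⟩ := exists_quasi_of_flat_equation he
  exact H D fun p hp => h _ _ (hT p hp)

/-- A homomorphism preserves the premises, so one separating the two sides of the conclusion would
refute the quasi-identity in `A`. -/
theorem quasi_of_separated {L : FirstOrder.Language.{0, 0}} {A D : Type} [L.Structure A]
    [L.Structure D] (h : ∀ a b : D, a ≠ b → ∃ f : D →[L] A, f a ≠ f b) (C : List (Equation L))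
    (c : Equation L) (hA : SatisfiesQuasi A C c) : SatisfiesQuasi D C c := by
  intro w hw
  by_contra hne
  obtain ⟨f, hf⟩ := h _ _ hne
  apply hf
  rw [← HomClass.realize_term, ← HomClass.realize_term]
  refine hA _ fun d hd => ?_
  rw [HomClass.realize_term, HomClass.realize_term, hw d hd]

end Lattice

/-! ### Operations of algebras of the flat signature -/

section Operations

/-- The meet operation of an algebra of the signature of lattices. -/
def linf {D : Type} [latticeLanguage.Structure D] (x y : D) : D :=
  Structure.funMap infSymbol ![x, y]

/-- The join operation of an algebra of the signature of lattices. -/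
def lsup {D : Type} [latticeLanguage.Structure D] (x y : D) : D :=
  Structure.funMap supSymbol ![x, y]

variable {S : Type} [flatLat.Structure S]

/-- The constant `0`. -/
def fzero (S : Type) [flatLat.Structure S] : S :=
  Structure.funMap (zeroSymbol (L := latticeLanguage)) ![]

/-- The flat meet. -/
def fmeet (x y : S) : S := Structure.funMap (meetSymbol (L := latticeLanguage)) ![x, y]

/-- The lattice meet. -/
def finf (x y : S) : S := Structure.funMap (origSymbol infSymbol) ![x, y]

/-- The lattice join. -/
def fsup (x y : S) : S := Structure.funMap (origSymbol supSymbol) ![x, y]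

/-- The restriction `(x ∨ y) ∧ x` of `x` to the support of `y`. -/
def res (x y : S) : S := finf (fsup x y) x

variable {α : Type}

/-- The term `0`. -/
def tzero : flatLat.Term α := .func (zeroSymbol (L := latticeLanguage)) ![]

/-- Flat meet of terms. -/
def tmeet (s t : flatLat.Term α) : flatLat.Term α :=
  (meetSymbol (L := latticeLanguage)).apply₂ s t

/-- Lattice meet of terms. -/
def tinf (s t : flatLat.Term α) : flatLat.Term α := (origSymbol infSymbol).apply₂ s t

/-- Lattice join of terms. -/
def tsup (s t : flatLat.Term α) : flatLat.Term α := (origSymbol supSymbol).apply₂ s t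

/-- Restriction of terms. -/
def tres (s t : flatLat.Term α) : flatLat.Term α := tinf (tsup s t) s

@[simp] theorem realize_tzero (v : α → S) : (tzero (α := α)).realize v = fzero S := by
  rw [tzero, Term.realize_func, fzero]
  exact congrArg _ (Subsingleton.elim _ _)

@[simp] theorem realize_tmeet (v : α → S) (s t : flatLat.Term α) :
    (tmeet s t).realize v = fmeet (s.realize v) (t.realize v) :=
  Term.realize_functions_apply₂

@[simp] theorem realize_tinf (v : α → S) (s t : flatLat.Term α) :
    (tinf s t).realize v = finf (s.realize v) (t.realize v) :=
  Term.realize_functions_apply₂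

@[simp] theorem realize_tsup (v : α → S) (s t : flatLat.Term α) :
    (tsup s t).realize v = fsup (s.realize v) (t.realize v) :=
  Term.realize_functions_apply₂

@[simp] theorem realize_tres (v : α → S) (s t : flatLat.Term α) :
    (tres s t).realize v = res (s.realize v) (t.realize v) := by
  simp [tres, res]

end Operations

/-! ### Equations of flat extensions against quasi-identities -/

section FlatOperations

variable {D : Type} [latticeLanguage.Structure D]

@[simp] theorem fzero_flat : fzero (Flat D) = none := rfl

@[simp] theorem fmeet_self_flat (x : Flat D) : fmeet x x = x := flat_funMap_meet_eq rfl

theorem fmeet_ne_flat {x y : Flat D} (h : x ≠ y) : fmeet x y = none := flat_funMap_meet_ne h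

theorem fmeet_some_iff {x y : Flat D} {d : D} :
    fmeet x y = some d ↔ x = some d ∧ y = some d := by
  by_cases h : x = y
  · subst h
    simp
  · rw [fmeet_ne_flat h]
    constructor
    · intro h'
      cases h'
    · rintro ⟨rfl, rfl⟩
      exact absurd rfl h

@[simp] theorem finf_some (a b : D) : finf (some a : Flat D) (some b) = some (linf a b) := by
  rw [finf, linf, ← flat_funMap_some]
  congr 1
  funext i
  fin_cases i <;> rfl

@[simp] theorem fsup_some (a b : D) : fsup (some a : Flat D) (some b) = some (lsup a b) := by
  rw [fsup, lsup, ← flat_funMap_some]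
  congr 1
  funext i
  fin_cases i <;> rfl

@[simp] theorem finf_none_left (x : Flat D) : finf none x = none :=
  flat_funMap_none infSymbol (i := 0) rfl

@[simp] theorem finf_none_right (x : Flat D) : finf x none = none :=
  flat_funMap_none infSymbol (i := 1) rfl

@[simp] theorem fsup_none_left (x : Flat D) : fsup none x = none :=
  flat_funMap_none supSymbol (i := 0) rfl

@[simp] theorem fsup_none_right (x : Flat D) : fsup x none = none :=
  flat_funMap_none supSymbol (i := 1) rfl

@[simp] theorem res_none_left (x : Flat D) : res none x = none := by simp [res]

@[simp] theorem res_none_right (x : Flat D) : res x none = none := by simp [res]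

variable {A : Type} [Lattice A]

@[simp] theorem linf_eq (a b : A) : linf a b = a ⊓ b := rfl

@[simp] theorem lsup_eq (a b : A) : lsup a b = a ⊔ b := rfl

@[simp] theorem res_some_lattice (a b : A) : res (some a : Flat A) (some b) = some a := by
  simp [res]

/-- Absorption in `D` is expressed by an equation of flat extensions of lattices. -/
theorem res_some_of_equations
    (h : ∀ e : Equation flatLat, SatisfiesEquation (Flat A) e → SatisfiesEquation (Flat D) e)
    (a b : D) : res (some a : Flat D) (some b) = some a := by
  -- The equation says that `res x y` is 0 or `x`. On elements of `D` the operations never give 0.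
  have := h (tmeet (tres (.var 0) (.var 1)) (.var 0), tres (.var 0) (.var 1)) (fun v => by
    simp only [realize_tmeet, realize_tres, Term.realize_var]
    cases v 0 <;> cases v 1 <;> simp [fmeet_ne_flat]) (fun k => if k = 0 then some a else some b)
  simp only [realize_tmeet, realize_tres, Term.realize_var, if_true, one_ne_zero, if_false] at this
  have h2 : res (some a : Flat D) (some b) = some (linf (lsup a b) a) := by simp [res]
  rw [h2, fmeet_some_iff] at this
  rw [h2, ← this.2]

/-- Restriction of `x` to the solution set of a list of equations. -/
def guard (C : List (Equation latticeLanguage)) (x : flatLat.Term ℕ) : flatLat.Term ℕ :=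
  C.foldr (fun d y => tres y (tmeet (liftTerm d.1) (liftTerm d.2))) x

/-- The flat meet of the two sides of a premise is nonzero exactly where they are nonzero and agree.
By absorption in `D`, restricting to it either leaves an element alone or kills it. -/
theorem realize_guard (hres : ∀ a b : D, res (some a : Flat D) (some b) = some a)
    (C : List (Equation latticeLanguage)) (x : flatLat.Term ℕ) (v : ℕ → Flat D) :
    ((∀ d ∈ C, (tmeet (liftTerm d.1) (liftTerm d.2)).realize v ≠ none) →
      (guard C x).realize v = x.realize v) ∧
    ((∃ d ∈ C, (tmeet (liftTerm d.1) (liftTerm d.2)).realize v = none) →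
      (guard C x).realize v = none) := by
  induction C with
  | nil => simp [guard]
  | cons d C ih =>
    have e : guard (d :: C) x =
        tres (guard C x) (tmeet (liftTerm d.1) (liftTerm d.2)) := rfl
    rw [e, realize_tres, List.forall_mem_cons, List.exists_mem_cons_iff]
    refine ⟨fun ⟨h1, h2⟩ => ?_, fun h => ?_⟩
    · obtain ⟨b, hb⟩ := Option.ne_none_iff_exists'.1 h1
      rw [ih.1 h2, hb]
      cases x.realize v with
      | none => simp
      | some a => exact hres a b
    · rcases h with h | h
      · rw [h, res_none_right]
      · rw [ih.2 h, res_none_left]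

/-- If the flat extension of `D` satisfies the equations of the flat extension of the lattice `A`,
then `D` satisfies the quasi-identities of `A`. -/
theorem quasi_of_flat_equations
    (h : ∀ e : Equation flatLat, SatisfiesEquation (Flat A) e → SatisfiesEquation (Flat D) e)
    (C : List (Equation latticeLanguage)) (c : Equation latticeLanguage)
    (hA : SatisfiesQuasi A C c) : SatisfiesQuasi D C c := by
  intro w hw
  -- On the solutions of `C`, the equation compares the left side of `c`, restricted to the support
  -- of the right side, with the flat meet of both. These agree when the two sides are equal or one
  -- of them is 0.
  have key := h (guard C (tres (liftTerm c.1) (liftTerm c.2)),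
    guard C (tmeet (liftTerm c.1) (liftTerm c.2))) (fun v => ?_) (fun k => some (w k))
  · have hC : ∀ d ∈ C, (tmeet (liftTerm d.1) (liftTerm d.2)).realize
        (fun k => (some (w k) : Flat D)) ≠ none := fun d hd => by
      rw [realize_tmeet, realize_liftTerm_some, realize_liftTerm_some, hw d hd, fmeet_self_flat]
      exact Option.some_ne_none _
    have hres := res_some_of_equations h
    dsimp only at key
    rw [(realize_guard hres C _ _).1 hC, (realize_guard hres C _ _).1 hC, realize_tres,
      realize_tmeet, realize_liftTerm_some, realize_liftTerm_some, hres] at key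
    have := fmeet_some_iff.1 key.symm
    exact (Option.some_injective _ this.2).symm
  · dsimp only
    by_cases hC : ∀ d ∈ C, (tmeet (liftTerm d.1) (liftTerm d.2)).realize v ≠ none
    · rw [(realize_guard res_some_lattice C _ _).1 hC, (realize_guard res_some_lattice C _ _).1 hC,
        realize_tres, realize_tmeet]
      by_cases hA' : Nonempty A
      · obtain ⟨a⟩ := hA'
        -- Variables with value 0 receive the arbitrary default `a`; they do not occur in the terms
        -- whose values are nonzero.
        have hv : ∀ k, v k = none ∨ v k = some ((v k).getD a) := fun k => by
          cases v k <;> simp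
        have hw' : ∀ d ∈ C, d.1.realize (fun k => (v k).getD a) =
            d.2.realize (fun k => (v k).getD a) := fun d hd => by
          obtain ⟨b, hb⟩ := Option.ne_none_iff_exists'.1 (hC d hd)
          rw [realize_tmeet, fmeet_some_iff] at hb
          have h1 := (realize_liftTerm_cases d.1 hv).resolve_left (by simp [hb.1])
          have h2 := (realize_liftTerm_cases d.2 hv).resolve_left (by simp [hb.2])
          rw [hb.1] at h1
          rw [hb.2] at h2
          exact Option.some_injective _ (h1.symm.trans h2)
        have hc := hA _ hw'
        rcases realize_liftTerm_cases c.1 hv with h1 | h1 <;>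
          rcases realize_liftTerm_cases c.2 hv with h2 | h2 <;> rw [h1, h2]
        · simp
        · rw [res_none_left, fmeet_ne_flat (Option.some_ne_none _).symm]
        · rw [res_none_right, fmeet_ne_flat (Option.some_ne_none _)]
        · rw [res_some_lattice, hc, fmeet_self_flat]
      · cases (liftTerm c.1).realize v with
        | some a => exact absurd ⟨a⟩ hA'
        | none => cases (liftTerm c.2).realize v with
          | some a => exact absurd ⟨a⟩ hA'
          | none => simp
    · push Not at hC
      rw [(realize_guard res_some_lattice C _ _).2 hC, (realize_guard res_some_lattice C _ _).2 hC]

/-- Membership of flat extensions in the variety of a flat extension of a lattice. -/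
theorem memVariety_flat_iff [Nonempty A] :
    MemVariety flatLat (Flat A) (Flat D) ↔
      ∀ C c, SatisfiesQuasi (L := latticeLanguage) A C c → SatisfiesQuasi D C c :=
  memVariety_iff.trans ⟨quasi_of_flat_equations, flat_equations_of_quasi⟩

end FlatOperations

/-! ### Universal Horn sentences of lattices -/

section Horn

/-- A bound term as a term in the variables `0, 1, …`. -/
def unboundTerm {n : ℕ} (t : latticeLanguage.Term (Empty ⊕ Fin n)) : latticeLanguage.Term ℕ :=
  t.relabel (Sum.elim Empty.elim fun i : Fin n => (i : ℕ))

theorem realize_unboundTerm {M : Type} [latticeLanguage.Structure M] {n : ℕ}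
    (t : latticeLanguage.Term (Empty ⊕ Fin n)) (w : ℕ → M) :
    (unboundTerm t).realize w = t.realize (Sum.elim default fun i : Fin n => w i) := by
  rw [unboundTerm, Term.realize_relabel]
  congr 1
  funext i
  rcases i with i | i
  · exact i.elim
  · rfl

theorem IsHornClause.exists_quasi {n : ℕ} {φ : latticeLanguage.BoundedFormula Empty n}
    (h : IsHornClause φ) : ∃ C : List (Equation latticeLanguage),
      (∃ c : Equation latticeLanguage, ∀ (M : Type) [latticeLanguage.Structure M] (w : ℕ → M),
        φ.Realize default (fun i => w i) ↔
          ((∀ d ∈ C, d.1.realize w = d.2.realize w) → c.1.realize w = c.2.realize w)) ∨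
      ∀ (M : Type) [latticeLanguage.Structure M] (w : ℕ → M),
        φ.Realize default (fun i => w i) ↔ ¬ ∀ d ∈ C, d.1.realize w = d.2.realize w := by
  induction h with
  | atomic h =>
    cases h with
    | equal t s =>
      exact ⟨[], Or.inl ⟨(unboundTerm t, unboundTerm s), fun M _ w => by
        simp [realize_unboundTerm]⟩⟩
    | rel R => exact isEmptyElim R
  | falsum => exact ⟨[], Or.inr fun M _ w => by simp⟩
  | imp hα _ ih =>
    cases hα with
    | rel R => exact isEmptyElim R
    | equal t s =>
      obtain ⟨C, ⟨c, hc⟩ | hc⟩ := ih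
      · refine ⟨(unboundTerm t, unboundTerm s) :: C, Or.inl ⟨c, fun M _ w => ?_⟩⟩
        rw [BoundedFormula.realize_imp, hc, BoundedFormula.realize_bdEqual, List.forall_mem_cons,
          realize_unboundTerm, realize_unboundTerm, and_imp]
      · refine ⟨(unboundTerm t, unboundTerm s) :: C, Or.inr fun M _ w => ?_⟩
        rw [BoundedFormula.realize_imp, hc, BoundedFormula.realize_bdEqual, List.forall_mem_cons,
          realize_unboundTerm, realize_unboundTerm, not_and]

variable {A D : Type} [Lattice A] [Nonempty A] [latticeLanguage.Structure D] [Nonempty D]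

theorem exists_extend {M : Type} [Nonempty M] {n : ℕ} (xs : Fin n → M) :
    ∃ w : ℕ → M, (fun i : Fin n => w i) = xs := by
  obtain ⟨a⟩ := ‹Nonempty M›
  exact ⟨fun k => if h : k < n then xs ⟨k, h⟩ else a, funext fun i => by simp⟩

/-- A clause is a quasi-identity or purely negative. The latter fails in `A` at a constant
assignment, so only quasi-identities remain. -/
theorem IsHornClause.realize_of_quasi
    (h : ∀ C c, SatisfiesQuasi (L := latticeLanguage) A C c → SatisfiesQuasi D C c) {n : ℕ}
    {φ : latticeLanguage.BoundedFormula Empty n} (hφ : IsHornClause φ)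
    (hA : ∀ xs : Fin n → A, φ.Realize default xs) (xs : Fin n → D) : φ.Realize default xs := by
  obtain ⟨w, rfl⟩ := exists_extend xs
  obtain ⟨C, ⟨c, hc⟩ | hc⟩ := hφ.exists_quasi
  · rw [hc]
    exact h C c (fun w => (hc A w).1 (hA _)) w
  · obtain ⟨a⟩ := ‹Nonempty A›
    refine absurd (fun d _ => ?_) ((hc A fun _ => a).1 (hA _))
    rw [realize_const, realize_const]

theorem IsHorn.realize_of_quasi
    (h : ∀ C c, SatisfiesQuasi (L := latticeLanguage) A C c → SatisfiesQuasi D C c) {n : ℕ}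
    {φ : latticeLanguage.BoundedFormula Empty n} (hφ : IsHorn φ)
    (hA : ∀ xs : Fin n → A, φ.Realize default xs) (xs : Fin n → D) : φ.Realize default xs := by
  induction hφ with
  | clause hφ => exact hφ.realize_of_quasi h hA xs
  | and _ _ h1 h2 =>
    simp only [BoundedFormula.realize_inf] at hA ⊢
    exact ⟨h1 fun xs => (hA xs).1, h2 fun xs => (hA xs).2⟩

theorem IsUniversalHorn.realize_of_quasi
    (h : ∀ C c, SatisfiesQuasi (L := latticeLanguage) A C c → SatisfiesQuasi D C c) {n : ℕ}
    {φ : latticeLanguage.BoundedFormula Empty n} (hφ : IsUniversalHorn φ)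
    (hA : ∀ xs : Fin n → A, φ.Realize default xs) (xs : Fin n → D) : φ.Realize default xs := by
  induction hφ with
  | of_isHorn hφ => exact hφ.realize_of_quasi h hA xs
  | all _ ih =>
    intro a
    refine ih (fun ys => ?_) _
    have := hA (Fin.init ys) (ys (Fin.last _))
    rwa [Fin.snoc_init_self] at this

theorem models_of_quasi
    (h : ∀ C c, SatisfiesQuasi (L := latticeLanguage) A C c → SatisfiesQuasi D C c)
    {ψ : latticeLanguage.Sentence} (hψ : IsUniversalHorn ψ) (hA : A ⊨ ψ) : D ⊨ ψ :=
  hψ.realize_of_quasi h (fun xs => by rwa [Subsingleton.elim xs default]) default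

/-- If the variety of the flat extension of `A` is finitely based, then so is the universal Horn
theory of `A`. -/
theorem VarietyFinitelyBased.hasFiniteUniversalHornBasis
    (h : VarietyFinitelyBased flatLat (Flat A)) :
    HasFiniteUniversalHornBasis latticeLanguage A := by
  classical
  obtain ⟨E, hE⟩ := h
  have hEA : ∀ e ∈ E, SatisfiesEquation (Flat A) e :=
    (hE (Flat A)).2 (memVariety_iff.2 fun _ => id)
  -- Each basis equation is traded for finitely many quasi-identities of `A`. A model `M` of all of
  -- these has `Flat M` in the variety, hence satisfies every quasi-identity of `A`.
  choose T hTA hT using fun e : E => exists_quasi_of_flat_equation (hEA e.1 e.2)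
  choose σ hσ hσM using fun p : List (Equation latticeLanguage) × Equation latticeLanguage =>
    exists_hornSentence p.1 p.2
  refine ⟨Finset.univ.biUnion fun e => (T e).toFinset.image σ, ?_, ?_⟩
  · intro φ hφ
    simp only [Finset.mem_biUnion, Finset.mem_univ, true_and, Finset.mem_image,
      List.mem_toFinset] at hφ
    obtain ⟨e, p, hp, rfl⟩ := hφ
    exact ⟨hσ p, (hσM p A).2 (hTA e p hp)⟩
  · intro M _ _ hM ψ hψ hAψ
    refine models_of_quasi (A := A) (memVariety_flat_iff.1 ((hE (Flat M)).1 fun e he => ?_)) hψ hAψ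
    refine hT ⟨e, he⟩ M fun p hp => (hσM p M).1 (hM _ ?_)
    simp only [Finset.mem_biUnion, Finset.mem_univ, true_and, Finset.mem_image, List.mem_toFinset]
    exact ⟨_, p, hp, rfl⟩

/-- A finite algebra satisfying the quasi-identities of `A` is separated by homomorphisms
to `A`. -/
theorem exists_hom_of_quasi {A D : Type} [Lattice A] [latticeLanguage.Structure D] [Finite D]
    (h : ∀ C c, SatisfiesQuasi (L := latticeLanguage) A C c → SatisfiesQuasi D C c) {a b : D}
    (hab : a ≠ b) : ∃ f : D → A, f a ≠ f b ∧ (∀ x y, f (linf x y) = f x ⊓ f y) ∧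
      ∀ x y, f (lsup x y) = f x ⊔ f y := by
  classical
  obtain ⟨n, ⟨eqv⟩⟩ := Finite.exists_equiv_fin D
  have := Fintype.ofFinite D
  let var : D → latticeLanguage.Term ℕ := fun d => .var (eqv d)
  -- `C` lists the operation tables of `D`, so its solutions in `A` are the homomorphisms. If none
  -- separated `a` and `b`, then `C → a = b` would hold in `A` but fail in `D` at its own elements.
  let C : List (Equation latticeLanguage) :=
    ((Finset.univ : Finset (D × D)).toList.map fun p =>
      (infSymbol.apply₂ (var p.1) (var p.2), var (linf p.1 p.2))) ++
    ((Finset.univ : Finset (D × D)).toList.map fun p =>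
      (supSymbol.apply₂ (var p.1) (var p.2), var (lsup p.1 p.2)))
  by_contra! hcon
  have hq : SatisfiesQuasi A C (var a, var b) := by
    intro w hw
    by_contra hne
    obtain ⟨x, y, hxy⟩ := hcon (fun d => w (eqv d)) hne fun x y => by
      have := hw (_, _) (List.mem_append_left _ (List.mem_map.2 ⟨(x, y), by simp, rfl⟩))
      simp only [Term.realize_functions_apply₂] at this
      exact this.symm
    refine hxy ?_
    have := hw (_, _) (List.mem_append_right _ (List.mem_map.2 ⟨(x, y), by simp, rfl⟩))
    simp only [Term.realize_functions_apply₂] at this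
    exact this.symm
  have hn : ∀ d : D, (fun k => if h : k < n then eqv.symm ⟨k, h⟩ else a) (eqv d : ℕ) = d := by
    intro d
    simp
  have := h C _ hq (fun k => if h : k < n then eqv.symm ⟨k, h⟩ else a) (fun d hd => by
    simp only [C, List.mem_append, List.mem_map] at hd
    rcases hd with ⟨p, -, rfl⟩ | ⟨p, -, rfl⟩
    · simp only [Term.realize_functions_apply₂, var, Term.realize_var, hn]
      rfl
    · simp only [Term.realize_functions_apply₂, var, Term.realize_var, hn]
      rfl)
  simp only [var, Term.realize_var, hn] at this
  exact hab this

end Horn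

/-! ### Homomorphisms in the two signatures -/

section Homs

/-- Homomorphisms of algebras of the flat signature. -/
def flatHom {S T : Type} [flatLat.Structure S] [flatLat.Structure T] (f : S → T)
    (h0 : f (fzero S) = fzero T) (hm : ∀ x y, f (fmeet x y) = fmeet (f x) (f y))
    (hi : ∀ x y, f (finf x y) = finf (f x) (f y))
    (hs : ∀ x y, f (fsup x y) = fsup (f x) (f y)) : S →[flatLat] T where
  toFun := f
  map_fun' := by
    have e2 : ∀ {M : Type} (x : Fin 2 → M), x = ![x 0, x 1] := fun x => by
      funext i
      fin_cases i <;> rfl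
    intro n g xs
    rcases g with g | g <;> rcases g with _ | _
    · rw [e2 xs, e2 (f ∘ _)]
      exact hi _ _
    · rw [e2 xs, e2 (f ∘ _)]
      exact hs _ _
    · rw [Subsingleton.elim xs ![], Subsingleton.elim (f ∘ _) (![])]
      exact h0
    · rw [e2 xs, e2 (f ∘ _)]
      exact hm _ _
  map_rel' := fun {_} r => isEmptyElim r

/-- Homomorphisms of algebras of the signature of lattices. -/
def latHom {S T : Type} [latticeLanguage.Structure S] [latticeLanguage.Structure T] (f : S → T)
    (hi : ∀ x y, f (linf x y) = linf (f x) (f y))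
    (hs : ∀ x y, f (lsup x y) = lsup (f x) (f y)) : S →[latticeLanguage] T where
  toFun := f
  map_fun' := by
    have e2 : ∀ {M : Type} (x : Fin 2 → M), x = ![x 0, x 1] := fun x => by
      funext i
      fin_cases i <;> rfl
    intro n g xs
    rcases g with _ | _
    · rw [e2 xs, e2 (f ∘ _)]
      exact hi _ _
    · rw [e2 xs, e2 (f ∘ _)]
      exact hs _ _
  map_rel' := fun {_} r => isEmptyElim r

/-- The algebra of the signature of lattices with given operations. -/
abbrev structureOfOps {D : Type} (inf sup : D → D → D) : latticeLanguage.Structure D where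
  funMap := fun {_} f =>
    match f with
    | LatticeSymbol.inf => fun x => inf (x 0) (x 1)
    | LatticeSymbol.sup => fun x => sup (x 0) (x 1)
  RelMap := fun r _ => nomatch r

end Homs

/-! ### The laws of flat extensions and the fibres -/

section Fiber

/-- A finite list of equations of flat extensions of lattices. -/
def flatLaws : List (Equation flatLat) :=
  let e : flatLat.Term ℕ := .var 0
  let x : flatLat.Term ℕ := .var 1
  let y : flatLat.Term ℕ := .var 2
  [(tres x tzero, tzero),
   (tsup tzero x, tzero),
   (tres x x, x),
   (tmeet x x, x),
   (tres (tres x e) e, tres x e),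
   (tres e (tres x e), tres e x),
   (tres e (tinf x y), tres (tres e x) y),
   (tres e (tsup x y), tres (tres e x) y),
   (tres (tres e x) y, tres (tres e y) x),
   (tres (tinf x y) e, tinf (tres x e) (tres y e)),
   (tres (tsup x y) e, tsup (tres x e) (tres y e)),
   (tres (tres x e) y, tres x (tres e y)),
   (tres x (tmeet x y), tmeet x y),
   (tres y (tmeet x y), tmeet x y),
   (tres (tres e (tmeet x y)) x, tres e (tmeet x y)),
   (tres (tres e (tmeet x y)) y, tres e (tmeet x y)),
   (tres e (tmeet (tres x e) (tres y e)), tres e (tmeet x y))]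

theorem flatLaws_flat {A : Type} [Lattice A] :
    ∀ l ∈ flatLaws, SatisfiesEquation (Flat A) l := by
  intro l hl v
  obtain ⟨e, he⟩ : ∃ e, v 0 = e := ⟨_, rfl⟩
  obtain ⟨x, hx⟩ : ∃ x, v 1 = x := ⟨_, rfl⟩
  obtain ⟨y, hy⟩ : ∃ y, v 2 = y := ⟨_, rfl⟩
  revert l
  simp only [flatLaws, List.forall_mem_cons, List.not_mem_nil, false_imp_iff, implies_true,
    and_true, realize_tres, realize_tzero, realize_tsup, realize_tinf, realize_tmeet,
    Term.realize_var, he, hx, hy]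
  rcases eq_or_ne x y with rfl | h
  · cases e <;> cases x <;> simp
  · rw [fmeet_ne_flat h]
    cases e <;> cases x <;> cases y <;> simp [fmeet_ne_flat, h] at h ⊢

variable {S : Type} [flatLat.Structure S]

variable (S) in
/-- The conjunction of the equations `flatLaws`. -/
structure FlatLaws : Prop where
  res_zero (x : S) : res x (fzero S) = fzero S
  sup_zero (x : S) : fsup (fzero S) x = fzero S
  res_self (x : S) : res x x = x
  meet_self (x : S) : fmeet x x = x
  res_res_self (e x : S) : res (res x e) e = res x e
  res_res_swap (e x : S) : res e (res x e) = res e x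
  res_inf (e x y : S) : res e (finf x y) = res (res e x) y
  res_sup (e x y : S) : res e (fsup x y) = res (res e x) y
  res_comm (e x y : S) : res (res e x) y = res (res e y) x
  inf_res (e x y : S) : res (finf x y) e = finf (res x e) (res y e)
  sup_res (e x y : S) : res (fsup x y) e = fsup (res x e) (res y e)
  res_assoc (e x y : S) : res (res x e) y = res x (res e y)
  res_meet_left (x y : S) : res x (fmeet x y) = fmeet x y
  res_meet_right (x y : S) : res y (fmeet x y) = fmeet x y
  meet_res_left (e x y : S) : res (res e (fmeet x y)) x = res e (fmeet x y)
  meet_res_right (e x y : S) : res (res e (fmeet x y)) y = res e (fmeet x y)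
  res_meet_res (e x y : S) : res e (fmeet (res x e) (res y e)) = res e (fmeet x y)

theorem FlatLaws.of_realize
    (h : ∀ e x y : S, ∃ v : ℕ → S, v 0 = e ∧ v 1 = x ∧ v 2 = y ∧
      ∀ l ∈ flatLaws, l.1.realize v = l.2.realize v) : FlatLaws S := by
  choose v he hx hy h' using h
  simp only [flatLaws, List.forall_mem_cons, List.not_mem_nil, false_imp_iff, implies_true,
    and_true, realize_tres, realize_tzero, realize_tsup, realize_tinf, realize_tmeet,
    Term.realize_var, he, hx, hy] at h'
  constructor
  · exact fun x => (h' x x x).1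
  · exact fun x => (h' x x x).2.1
  · exact fun x => (h' x x x).2.2.1
  · exact fun x => (h' x x x).2.2.2.1
  · exact fun e x => (h' e x x).2.2.2.2.1
  · exact fun e x => (h' e x x).2.2.2.2.2.1
  · exact fun e x y => (h' e x y).2.2.2.2.2.2.1
  · exact fun e x y => (h' e x y).2.2.2.2.2.2.2.1
  · exact fun e x y => (h' e x y).2.2.2.2.2.2.2.2.1
  · exact fun e x y => (h' e x y).2.2.2.2.2.2.2.2.2.1
  · exact fun e x y => (h' e x y).2.2.2.2.2.2.2.2.2.2.1
  · exact fun e x y => (h' e x y).2.2.2.2.2.2.2.2.2.2.2.1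
  · exact fun x y => (h' x x y).2.2.2.2.2.2.2.2.2.2.2.2.1
  · exact fun x y => (h' x x y).2.2.2.2.2.2.2.2.2.2.2.2.2.1
  · exact fun e x y => (h' e x y).2.2.2.2.2.2.2.2.2.2.2.2.2.2.1
  · exact fun e x y => (h' e x y).2.2.2.2.2.2.2.2.2.2.2.2.2.2.2.1
  · exact fun e x y => (h' e x y).2.2.2.2.2.2.2.2.2.2.2.2.2.2.2.2

theorem FlatLaws.of_memVariety {A : Type} [Lattice A] [Nonempty S]
    (h : MemVariety flatLat (Flat A) S) : FlatLaws S :=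
  .of_realize fun e x y => ⟨fun k => if k = 0 then e else if k = 1 then x else y, by simp, by simp,
    by simp, fun l hl => memVariety_iff.1 h l (flatLaws_flat l hl) _⟩

/-- The elements with the same support as `e`. -/
def IsFiber (e x : S) : Prop := res x e = x ∧ res e x = e

/-- The set of elements with the same support as `e`. -/
abbrev Fiber (e : S) : Type := {x : S // IsFiber e x}

namespace FlatLaws

variable (h : FlatLaws S) {e x y : S}

include h

theorem isFiber_inf (hx : IsFiber e x) (hy : IsFiber e y) : IsFiber e (finf x y) :=
  ⟨by rw [h.inf_res, hx.1, hy.1], by rw [h.res_inf, hx.2, hy.2]⟩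

theorem isFiber_sup (hx : IsFiber e x) (hy : IsFiber e y) : IsFiber e (fsup x y) :=
  ⟨by rw [h.sup_res, hx.1, hy.1], by rw [h.res_sup, hx.2, hy.2]⟩

theorem isFiber_res (hx : res e x = e) : IsFiber e (res x e) :=
  ⟨h.res_res_self e x, by rw [h.res_res_swap, hx]⟩

theorem res_left_of_res_res (hxy : res (res e x) y = e) : res e x = e ∧ res e y = e := by
  have key : ∀ x y, res (res e x) y = e → res e x = e := fun x y hxy => by
    have h1 : res (res e x) x = res e x := by rw [h.res_assoc, h.res_self]
    have h2 := congrArg (fun z => res z x) hxy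
    simp only [h.res_comm (res e x) y x, h1] at h2
    rw [← h2, hxy]
  exact ⟨key x y hxy, key y x (by rw [h.res_comm, hxy])⟩

/-- In a subalgebra of a power, `res e x = e` says that the support of `x` contains that of `e`, and
the flat meet is supported where both arguments are nonzero and agree. -/
theorem res_meet_iff : res e (fmeet x y) = e ↔ res e x = e ∧ res e y = e ∧ res x e = res y e := by
  constructor
  · intro hm
    have hx : res e x = e := by
      have := h.meet_res_left e x y
      rwa [hm] at this
    have hy : res e y = e := by
      have := h.meet_res_right e x y
      rwa [hm] at this
    refine ⟨hx, hy, ?_⟩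
    have h1 : res (fmeet x y) e = res x e := by
      rw [← h.res_meet_left, h.res_comm, h.res_assoc, hm]
    have h2 : res (fmeet x y) e = res y e := by
      conv_lhs => rw [← h.res_meet_right]
      rw [h.res_comm, h.res_assoc, hm]
    rw [← h1, h2]
  · rintro ⟨hx, hy, hxy⟩
    rw [← h.res_meet_res, ← hxy, h.meet_self, h.res_res_swap, hx]

theorem meet_res (hm : res e (fmeet x y) = e) : res (fmeet x y) e = res x e := by
  rw [← h.res_meet_left, h.res_comm, h.res_assoc, hm]

/-- The algebra of elements with the same support as `e`. -/
@[reducible] def fiberStructure (e : S) : latticeLanguage.Structure (Fiber e) :=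
  structureOfOps (fun x y => ⟨finf x.1 y.1, h.isFiber_inf x.2 y.2⟩)
    (fun x y => ⟨fsup x.1 y.1, h.isFiber_sup x.2 y.2⟩)

open Classical in
/-- The projection to the flat extension of a fibre. -/
noncomputable def toFiber (e x : S) : Flat (Fiber e) :=
  if hx : res e x = e then some ⟨res x e, h.isFiber_res hx⟩ else none

theorem toFiber_of (hx : res e x = e) : h.toFiber e x = some ⟨res x e, h.isFiber_res hx⟩ :=
  dif_pos hx

theorem toFiber_of_not (hx : res e x ≠ e) : h.toFiber e x = none := dif_neg hx

theorem toFiber_coe (x : Fiber e) : h.toFiber e x.1 = some x := by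
  rw [h.toFiber_of x.2.2]
  exact congrArg some (Subtype.ext x.2.1)

/-- The projection restricts `x` to the support of `e` if that lies in the support of `x`, and sends
`x` to 0 otherwise. For `e = 0` the element 0 would not be sent to 0. -/
theorem exists_toFiber_hom (he : e ≠ fzero S) :
    letI := h.fiberStructure e
    ∃ f : S →[flatLat] Flat (Fiber e), ∀ x, f x = h.toFiber e x := by
  let := h.fiberStructure e
  refine ⟨flatHom (h.toFiber e) ?_ ?_ ?_ ?_, fun _ => rfl⟩
  · exact h.toFiber_of_not (by rw [h.res_zero]; exact he.symm)
  · intro x y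
    by_cases hm : res e (fmeet x y) = e
    · obtain ⟨hx, hy, hxy⟩ := h.res_meet_iff.1 hm
      rw [h.toFiber_of hm, h.toFiber_of hx, h.toFiber_of hy]
      simp only [h.meet_res hm, ← hxy, fmeet_self_flat]
    · rw [h.toFiber_of_not hm]
      by_cases hx : res e x = e
      · by_cases hy : res e y = e
        · rw [fmeet_ne_flat]
          rw [h.toFiber_of hx, h.toFiber_of hy]
          intro heq
          exact hm (h.res_meet_iff.2 ⟨hx, hy, congrArg Subtype.val (Option.some_injective _ heq)⟩)
        · rw [h.toFiber_of hx, h.toFiber_of_not hy, fmeet_ne_flat (Option.some_ne_none _)]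
      · by_cases hy : res e y = e
        · rw [h.toFiber_of hy, h.toFiber_of_not hx, fmeet_ne_flat (Option.some_ne_none _).symm]
        · rw [h.toFiber_of_not hx, h.toFiber_of_not hy, fmeet_self_flat]
  · intro x y
    by_cases hm : res e (finf x y) = e
    · obtain ⟨hx, hy⟩ := h.res_left_of_res_res (by rwa [h.res_inf] at hm)
      rw [h.toFiber_of hm, h.toFiber_of hx, h.toFiber_of hy, finf_some]
      exact congrArg some (Subtype.ext (h.inf_res e x y))
    · rw [h.toFiber_of_not hm]
      by_cases hx : res e x = e
      · have hy : res e y ≠ e := fun hy => hm (by rw [h.res_inf, hx, hy])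
        rw [h.toFiber_of_not hy, finf_none_right]
      · rw [h.toFiber_of_not hx, finf_none_left]
  · intro x y
    by_cases hm : res e (fsup x y) = e
    · obtain ⟨hx, hy⟩ := h.res_left_of_res_res (by rwa [h.res_sup] at hm)
      rw [h.toFiber_of hm, h.toFiber_of hx, h.toFiber_of hy, fsup_some]
      exact congrArg some (Subtype.ext (h.sup_res e x y))
    · rw [h.toFiber_of_not hm]
      by_cases hx : res e x = e
      · have hy : res e y ≠ e := fun hy => hm (by rw [h.res_sup, hx, hy])
        rw [h.toFiber_of_not hy, fsup_none_right]
      · rw [h.toFiber_of_not hx, fsup_none_left]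

/-- If neither is 0 and the projections at `a` and at `b` do not separate them, then `a` and `b`
have the same support and agree on it. If one is 0, the projection at the other separates. -/
theorem exists_toFiber_ne {a b : S} (hab : a ≠ b) :
    ∃ e, e ≠ fzero S ∧ h.toFiber e a ≠ h.toFiber e b := by
  by_cases ha : a = fzero S
  · have hb : b ≠ fzero S := fun hb => hab (ha.trans hb.symm)
    refine ⟨b, hb, ?_⟩
    rw [h.toFiber_of (h.res_self b), h.toFiber_of_not (by rw [ha, h.res_zero]; exact hb.symm)]
    exact (Option.some_ne_none _).symm
  by_cases hb : b = fzero S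
  · refine ⟨a, ha, ?_⟩
    rw [h.toFiber_of (h.res_self a), h.toFiber_of_not (by rw [hb, h.res_zero]; exact Ne.symm ha)]
    exact Option.some_ne_none _
  by_contra! hcon
  have key : ∀ e x y : S, res e x = e → h.toFiber e x = h.toFiber e y →
      res e y = e ∧ res x e = res y e := fun e x y hx hxy => by
    by_cases hy : res e y = e
    · rw [h.toFiber_of hx, h.toFiber_of hy] at hxy
      exact ⟨hy, congrArg Subtype.val (Option.some_injective _ hxy)⟩
    · rw [h.toFiber_of hx, h.toFiber_of_not hy] at hxy
      exact absurd hxy (Option.some_ne_none _)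
  have h1 := key a a b (h.res_self a) (hcon a ha)
  have h2 := key b b a (h.res_self b) (hcon b hb).symm
  rw [h.res_self] at h1 h2
  exact hab (h2.1.symm.trans h1.2.symm).symm

end FlatLaws

end Fiber

/-! ### The sentence defining the finite members -/

section Coding

variable {A S : Type} [Lattice A] [flatLat.Structure S]

/-- `x` is sent to `i` by the map coded by the family `p` of least elements of principal
filters. -/
def CodedValue (p : A → S) (i : A) (x : S) : Prop := ∀ j, fsup (p j) x = x ↔ j ≤ i

/-- The family `p` codes a homomorphism from the fibre of `e` to `A` separating `a` and `b`, as
far as the elements `x` and `y` are concerned. -/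
def CodesAt (e a b : S) (p : A → S) (x y : S) : Prop :=
  e ≠ fzero S → IsFiber e a → IsFiber e b → a ≠ b →
    (IsFiber e x → ∃ i, CodedValue p i x) ∧
    (IsFiber e x → IsFiber e y → ∀ i k, CodedValue p i x → CodedValue p k y →
      CodedValue p (i ⊓ k) (finf x y) ∧ CodedValue p (i ⊔ k) (fsup x y)) ∧
    ∀ i, ¬ (CodedValue p i a ∧ CodedValue p i b)

theorem CodedValue.unique {p : A → S} {i k : A} {x : S} (hi : CodedValue p i x)
    (hk : CodedValue p k x) : i = k :=
  le_antisymm ((hk i).1 ((hi i).2 le_rfl)) ((hi k).1 ((hk k).2 le_rfl))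

variable (A S) in
/-- In every nonzero fibre, distinct elements are separated by coded homomorphisms to `A`. -/
def FibersSeparated : Prop :=
  ∀ e a b : S, ∃ p : A → S, ∀ x y, CodesAt e a b p x y

/-- A failing equation already fails in the flat extension of some nonzero fibre. The codes separate
the points of this fibre by homomorphisms to `A`, so it satisfies the quasi-identities of `A`. This
direction also covers infinite `S`. -/
theorem memVariety_of_fibersSeparated [Nonempty A] [Nonempty S] (h : FlatLaws S)
    (hS : FibersSeparated A S) : MemVariety flatLat (Flat A) S := by
  rw [memVariety_iff]
  intro q hq v
  by_contra hne
  obtain ⟨e, he, hne⟩ := h.exists_toFiber_ne hne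
  let := h.fiberStructure e
  obtain ⟨f, hf⟩ := h.exists_toFiber_hom he
  rw [← hf, ← hf, ← HomClass.realize_term, ← HomClass.realize_term] at hne
  refine hne (flat_equations_of_quasi (A := A) (quasi_of_separated fun a b hab => ?_) q hq _)
  obtain ⟨p, hp⟩ := hS e a.1 b.1
  have hp' := fun x y => hp x y he a.2 b.2 fun h => hab (Subtype.ext h)
  choose g hg using fun x : Fiber e => (hp' x.1 x.1).1 x.2
  refine ⟨latHom g (fun x y => ?_) (fun x y => ?_), fun heq => ?_⟩
  · exact (hg (linf x y)).unique ((hp' x.1 y.1).2.1 x.2 y.2 _ _ (hg x) (hg y)).1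
  · exact (hg (lsup x y)).unique ((hp' x.1 y.1).2.1 x.2 y.2 _ _ (hg x) (hg y)).2
  · have heq' : g a = g b := heq
    exact (hp' a.1 b.1).2.2 (g a) ⟨hg a, heq' ▸ hg b⟩

/-- The preimage of a principal filter under a homomorphism from a finite algebra is a principal
filter or empty. -/
theorem exists_least_of_quasi {D : Type} [latticeLanguage.Structure D] [Finite D]
    (h : ∀ C c, SatisfiesQuasi (L := latticeLanguage) A C c → SatisfiesQuasi D C c)
    (f : D → A) (hi : ∀ x y, f (linf x y) = f x ⊓ f y) (hs : ∀ x y, f (lsup x y) = f x ⊔ f y)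
    (j : A) (hj : ∃ x, j ≤ f x) : ∃ m, ∀ x, lsup m x = x ↔ j ≤ f x := by
  classical
  -- The lattice axioms are quasi-identities without premises, so they pass from `A` to `D`.
  have id3 : ∀ (t s : latticeLanguage.Term ℕ) (a b c : D),
      (∀ w : ℕ → A, t.realize w = s.realize w) →
      t.realize (fun k => if k = 0 then a else if k = 1 then b else c) =
        s.realize (fun k => if k = 0 then a else if k = 1 then b else c) := fun t s a b c hw =>
    h [] (t, s) (fun w _ => hw w) _ (by simp)
  let x : latticeLanguage.Term ℕ := .var 0
  let y : latticeLanguage.Term ℕ := .var 1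
  let z : latticeLanguage.Term ℕ := .var 2
  have ei : ∀ {M : Type} [latticeLanguage.Structure M] (w : ℕ → M)
      (t s : latticeLanguage.Term ℕ),
      (infSymbol.apply₂ t s).realize w = linf (t.realize w) (s.realize w) := fun w t s =>
    Term.realize_functions_apply₂
  have es : ∀ {M : Type} [latticeLanguage.Structure M] (w : ℕ → M)
      (t s : latticeLanguage.Term ℕ),
      (supSymbol.apply₂ t s).realize w = lsup (t.realize w) (s.realize w) := fun w t s =>
    Term.realize_functions_apply₂
  have sc : ∀ a b : D, lsup a b = lsup b a := fun a b => by
    simpa [es, x, y] using id3 (supSymbol.apply₂ x y) (supSymbol.apply₂ y x) a b b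
      fun w => by simp [es, x, y, sup_comm]
  have sa : ∀ a b c : D, lsup (lsup a b) c = lsup a (lsup b c) := fun a b c => by
    simpa [es, x, y, z] using id3 (supSymbol.apply₂ (supSymbol.apply₂ x y) z)
      (supSymbol.apply₂ x (supSymbol.apply₂ y z)) a b c
      fun w => by simp [es, x, y, z, sup_assoc]
  have ic : ∀ a b : D, linf a b = linf b a := fun a b => by
    simpa [ei, x, y] using id3 (infSymbol.apply₂ x y) (infSymbol.apply₂ y x) a b b
      fun w => by simp [ei, x, y, inf_comm]
  have ia : ∀ a b c : D, linf (linf a b) c = linf a (linf b c) := fun a b c => by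
    simpa [ei, x, y, z] using id3 (infSymbol.apply₂ (infSymbol.apply₂ x y) z)
      (infSymbol.apply₂ x (infSymbol.apply₂ y z)) a b c
      fun w => by simp [ei, x, y, z, inf_assoc]
  have si : ∀ a b : D, lsup a (linf a b) = a := fun a b => by
    simpa [es, ei, x, y] using id3 (supSymbol.apply₂ x (infSymbol.apply₂ x y)) x a b b
      fun w => by simp [es, ei, x, y]
  have is : ∀ a b : D, linf a (lsup a b) = a := fun a b => by
    simpa [es, ei, x, y] using id3 (infSymbol.apply₂ x (supSymbol.apply₂ x y)) x a b b
      fun w => by simp [es, ei, x, y]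
  let : Max D := ⟨lsup⟩
  let : Min D := ⟨linf⟩
  let : Lattice D := Lattice.mk' sc sa ic ia si is
  have := Fintype.ofFinite D
  -- The least element is the meet of the whole preimage, which is where finiteness of `D` is
  -- essential.
  have hne : (Finset.univ.filter fun x => j ≤ f x).Nonempty := by
    obtain ⟨x, hx⟩ := hj
    exact ⟨x, by simpa using hx⟩
  have hm : j ≤ f ((Finset.univ.filter fun x => j ≤ f x).inf' hne id) := by
    refine Finset.inf'_induction (p := fun x => j ≤ f x) hne id (fun a ha b hb => ?_)
      fun x hx => (Finset.mem_filter.1 hx).2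
    exact (le_inf ha hb).trans (hi a b).ge
  refine ⟨(Finset.univ.filter fun x => j ≤ f x).inf' hne id,
    fun x => ⟨fun hx => ?_, fun hx => ?_⟩⟩
  · rw [← hx, hs]
    exact hm.trans le_sup_left
  · exact sup_eq_right.2 (Finset.inf'_le id (Finset.mem_filter.2 ⟨Finset.mem_univ x, hx⟩))

/-- The flat extension of a fibre is an image of `S`, so the finite fibre is separated by
homomorphisms to `A`; `f x` is the largest `j` whose filter has its least preimage below `x`. -/
theorem fibersSeparated_of_memVariety [Nonempty S] [Finite S]
    (hS : MemVariety flatLat (Flat A) S) : FibersSeparated A S := by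
  classical
  have h := FlatLaws.of_memVariety hS
  intro e a b
  by_cases hab : e ≠ fzero S ∧ IsFiber e a ∧ IsFiber e b ∧ a ≠ b
  swap
  · exact ⟨fun _ => e, fun x y he ha hb hne => absurd ⟨he, ha, hb, hne⟩ hab⟩
  obtain ⟨he, ha, hb, hne⟩ := hab
  let := h.fiberStructure e
  obtain ⟨g, hg⟩ := h.exists_toFiber_hom he
  have hgs : Function.Surjective g := fun x => by
    cases x with
    | none => exact ⟨fzero S, by
        rw [hg]
        exact h.toFiber_of_not (by rw [h.res_zero]; exact he.symm)⟩
    | some x => exact ⟨x.1, by rw [hg, h.toFiber_coe]⟩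
  have hq := quasi_of_flat_equations (A := A) (D := Fiber e) fun q hq =>
    (memVariety_iff.1 hS q hq).of_surjective g hgs
  obtain ⟨f, hf, hi, hs⟩ := exists_hom_of_quasi (a := (⟨a, ha⟩ : Fiber e)) (b := ⟨b, hb⟩) hq
    fun h => hne (congrArg Subtype.val h)
  have hp : ∀ j, ∃ m : S, ∀ x : Fiber e, fsup m x.1 = x.1 ↔ j ≤ f x := fun j => by
    by_cases hj : ∃ x, j ≤ f x
    · obtain ⟨m, hm⟩ := exists_least_of_quasi hq f hi hs j hj
      exact ⟨m.1, fun x => Subtype.ext_iff.symm.trans (hm x)⟩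
    · push Not at hj
      -- An empty preimage is coded by 0, which absorbs under join and so is below no element of the
      -- nonzero fibre.
      refine ⟨fzero S, fun x => ⟨fun hx => absurd ?_ he, fun hx => absurd hx (hj x)⟩⟩
      have h1 := x.2.2
      rw [← hx, h.sup_zero, h.res_zero] at h1
      exact h1.symm
  choose p hp using hp
  have hv : ∀ (x : Fiber e) i, CodedValue p i x.1 ↔ i = f x := fun x i => by
    have h1 : CodedValue p (f x) x.1 := fun j => hp j x
    exact ⟨fun h => h.unique h1, fun h => h ▸ h1⟩
  refine ⟨p, fun x y _ _ _ _ => ⟨fun hx => ⟨_, (hv ⟨x, hx⟩ _).2 rfl⟩, fun hx hy i k hix hky => ?_,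
    fun i hii => hf ?_⟩⟩
  · rw [hv ⟨x, hx⟩] at hix
    rw [hv ⟨y, hy⟩] at hky
    subst hix hky
    rw [← hi, ← hs]
    exact ⟨(hv (linf _ _) _).2 rfl, (hv (lsup _ _) _).2 rfl⟩
  · exact ((hv ⟨a, ha⟩ i).1 hii.1).symm.trans ((hv ⟨b, hb⟩ i).1 hii.2)

end Coding

/-! ### Quantifier-free definability of the coding and the `∀*∃*∀*` sentence -/

section Sentence

/-- The variables of the term `t` are bounded by `n`. -/
def VarLE (n : ℕ) (t : flatLat.Term ℕ) : Prop := ∀ k ∈ t.varFinset, k ≤ n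

@[simp] theorem varLE_var {n k : ℕ} : VarLE n (.var k) ↔ k ≤ n := by
  simp [VarLE, Term.varFinset]

theorem varLE_func {n m : ℕ} {f : flatLat.Functions m} {ts : Fin m → flatLat.Term ℕ} :
    VarLE n (.func f ts) ↔ ∀ i, VarLE n (ts i) := by
  simp only [VarLE, Term.varFinset, Finset.mem_biUnion, Finset.mem_univ, true_and,
    forall_exists_index]
  exact forall_comm

@[simp] theorem varLE_tzero {n : ℕ} : VarLE n tzero := varLE_func.2 fun i => i.elim0

theorem varLE_apply₂ {n : ℕ} {f : flatLat.Functions 2} {t s : flatLat.Term ℕ} :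
    VarLE n (f.apply₂ t s) ↔ VarLE n t ∧ VarLE n s :=
  varLE_func.trans (by simp [Fin.forall_fin_two])

@[simp] theorem varLE_tmeet {n : ℕ} {t s : flatLat.Term ℕ} :
    VarLE n (tmeet t s) ↔ VarLE n t ∧ VarLE n s := varLE_apply₂

@[simp] theorem varLE_tinf {n : ℕ} {t s : flatLat.Term ℕ} :
    VarLE n (tinf t s) ↔ VarLE n t ∧ VarLE n s := varLE_apply₂

@[simp] theorem varLE_tsup {n : ℕ} {t s : flatLat.Term ℕ} :
    VarLE n (tsup t s) ↔ VarLE n t ∧ VarLE n s := varLE_apply₂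

@[simp] theorem varLE_tres {n : ℕ} {t s : flatLat.Term ℕ} :
    VarLE n (tres t s) ↔ VarLE n t ∧ VarLE n s := by
  simp [tres, and_comm]

theorem varLE_flatLaws {n : ℕ} (hn : 2 ≤ n) : ∀ l ∈ flatLaws, VarLE n l.1 ∧ VarLE n l.2 := by
  have h1 : 1 ≤ n := by omega
  simp [flatLaws, hn, h1]

theorem QFDef.realize_eq {n : ℕ} {t s : flatLat.Term ℕ} (ht : VarLE n t) (hs : VarLE n s) :
    QFDef (L := flatLat) (n + 1) (fun _ _ v => t.realize v = s.realize v) :=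
  QFDef.equation t s ht hs

variable {A : Type} [Lattice A] [Finite A]

theorem QFDef.isFiber {n : ℕ} {t s : flatLat.Term ℕ} (ht : VarLE n t) (hs : VarLE n s) :
    QFDef (L := flatLat) (n + 1) (fun _ _ v => IsFiber (t.realize v) (s.realize v)) := by
  have := (QFDef.realize_eq (t := tres s t) (s := s) (n := n) (by simp [ht, hs]) hs).and
    (QFDef.realize_eq (t := tres t s) (s := t) (n := n) (by simp [ht, hs]) ht)
  simp only [realize_tres] at this
  exact this

theorem QFDef.codedValue {n : ℕ} {p : A → flatLat.Term ℕ} {t : flatLat.Term ℕ}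
    (hp : ∀ j, VarLE n (p j)) (ht : VarLE n t) (i : A) :
    QFDef (L := flatLat) (n + 1)
      (fun _ _ v => CodedValue (fun j => (p j).realize v) i (t.realize v)) := by
  have := QFDef.forall fun j : A => (QFDef.realize_eq (t := tsup (p j) t) (s := t) (n := n)
    (by simp [ht, hp]) ht).iff (QFDef.const (n + 1) (j ≤ i))
  simp only [realize_tsup] at this
  exact this

theorem QFDef.codesAt {n : ℕ} {p : A → flatLat.Term ℕ} {e a b x y : flatLat.Term ℕ}
    (hp : ∀ j, VarLE n (p j)) (he : VarLE n e) (ha : VarLE n a) (hb : VarLE n b)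
    (hx : VarLE n x) (hy : VarLE n y) :
    QFDef (L := flatLat) (n + 1)
      (fun _ _ v => CodesAt (e.realize v) (a.realize v) (b.realize v)
        (fun j => (p j).realize v) (x.realize v) (y.realize v)) := by
  have h1 := (QFDef.realize_eq he (varLE_tzero (n := n))).not
  have h2 := (QFDef.realize_eq ha hb).not
  have h3 := (QFDef.isFiber he hx).imp (QFDef.exists fun i => QFDef.codedValue hp hx i)
  have h4 := (QFDef.isFiber he hx).imp ((QFDef.isFiber he hy).imp (QFDef.forall fun i : A =>
    QFDef.forall fun k : A => (QFDef.codedValue hp hx i).imp ((QFDef.codedValue hp hy k).imp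
      ((QFDef.codedValue (t := tinf x y) hp (by simp [hx, hy]) (i ⊓ k)).and
        (QFDef.codedValue (t := tsup x y) hp (by simp [hx, hy]) (i ⊔ k))))))
  have h5 := QFDef.forall fun i : A =>
    ((QFDef.codedValue hp ha i).and (QFDef.codedValue hp hb i)).not
  have := h1.imp ((QFDef.isFiber he ha).imp ((QFDef.isFiber he hb).imp
    (h2.imp (h3.and (h4.and h5)))))
  simp only [realize_tinf, realize_tsup, realize_tzero] at this
  exact this

variable (A) in
/-- The finite members of the variety of the flat extension of a finite lattice are defined by
a `∀*∃*∀*` sentence. -/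
theorem exists_definesFiniteMembers [Nonempty A] :
    ∃ Φ : flatLat.Sentence, IsForallExistsForall Φ ∧ DefinesFiniteMembers (Flat A) Φ := by
  obtain ⟨m, ⟨eqv⟩⟩ := Finite.exists_equiv_fin A
  have hle : ∀ j, VarLE (4 + m) (.var (3 + eqv j)) := fun j => by
    rw [varLE_var]
    have := (eqv j).2
    omega
  -- Variables 0, 1, 2 are `e, a, b` and also serve for the laws; the next `m` hold the code `p`;
  -- the last two, `3 + m` and `4 + m`, are `x, y`. The blocks thus have lengths 3, `m` and 2.
  have hQ := (QFDef.forall_mem_list (n := 4 + m + 1) flatLaws fun l hl =>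
      QFDef.realize_eq (varLE_flatLaws (n := 4 + m) (by omega) l hl).1
        (varLE_flatLaws (by omega) l hl).2).and
    (QFDef.codesAt (n := 4 + m) (p := fun j => .var (3 + eqv j)) (e := .var 0) (a := .var 1)
      (b := .var 2) (x := .var (3 + m)) (y := .var (4 + m)) hle (by simp) (by simp; omega)
      (by simp; omega) (by simp) (by simp))
  rw [show 4 + m + 1 = 3 + m + 2 by omega] at hQ
  obtain ⟨Φ, hΦ, H⟩ := hQ.forall_exists_forall
  refine ⟨Φ, hΦ, fun S _ _ _ => ?_⟩
  rw [H]
  simp only [Term.realize_var]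
  constructor
  · intro hS
    refine memVariety_of_fibersSeparated (.of_realize fun e x y => ?_) fun e a b => ?_
    · obtain ⟨v, hv, hv'⟩ := hS fun k => if k = 0 then e else if k = 1 then x else y
      exact ⟨v, by simp [hv], by simp [hv], by simp [hv], (hv' v fun _ _ => rfl).1⟩
    · obtain ⟨v, hv, hv'⟩ := hS fun k => if k = 0 then e else if k = 1 then a else b
      refine ⟨fun j => v (3 + eqv j), fun x y => ?_⟩
      have := (hv' (fun k => if k < 3 + m then v k else if k = 3 + m then x else y)
        fun k hk => if_pos hk).2
      have h0 : v 0 = e := by simp [hv]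
      have h1 : v 1 = a := by simp [hv]
      have h2 : v 2 = b := by simp [hv]
      have hm0 : 0 < 3 + m := by omega
      have hm1 : 1 < 3 + m := by omega
      have hm2 : 2 < 3 + m := by omega
      have hm4 : ¬ 4 + m < 3 + m := by omega
      have hm4' : 4 + m ≠ 3 + m := by omega
      have hm3 : ∀ j, 3 + (eqv j : ℕ) < 3 + m := fun j => by
        have := (eqv j).2
        omega
      simpa only [hm0, hm1, hm2, hm4, hm4', hm3, h0, h1, h2, if_true, if_false, lt_irrefl] using
        this
  · intro hS v
    obtain ⟨p, hp⟩ := fibersSeparated_of_memVariety hS (v 0) (v 1) (v 2)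
    refine ⟨fun k => if k < 3 then v k else if h : k - 3 < m then p (eqv.symm ⟨k - 3, h⟩) else v k,
      fun k hk => if_pos hk, fun v' hv' => ⟨fun l hl =>
        memVariety_iff.1 hS l (flatLaws_flat l hl) v', ?_⟩⟩
    have h0 : v' 0 = v 0 := hv' 0 (by omega)
    have h1 : v' 1 = v 1 := hv' 1 (by omega)
    have h2 : v' 2 = v 2 := hv' 2 (by omega)
    have h3 : ∀ j, v' (3 + eqv j) = p j := fun j => by
      rw [hv' _ (by have := (eqv j).2; omega)]
      simp
    simp only [h0, h1, h2, h3]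
    exact hp _ _

end Sentence

/-! ### Belkin's lattices -/

/-- Two copies of `M₃` glued along an edge: the lower copy is `o < a, b, c < d`, the upper copy
is `c < d, p, q < t`. -/
inductive M8 : Type
  | o | a | b | c | d | p | q | t
  deriving DecidableEq

namespace M8

instance : Fintype M8 where
  elems := {o, a, b, c, d, p, q, t}
  complete x := by cases x <;> decide

/-- The elements above a given one. -/
def above : M8 → List M8
  | o => [o, a, b, c, d, p, q, t]
  | a => [a, d, t]
  | b => [b, d, t]
  | c => [c, d, p, q, t]
  | d => [d, t]
  | p => [p, t]
  | q => [q, t]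
  | t => [t]

instance : LE M8 := ⟨fun x y => y ∈ above x⟩

instance : DecidableLE M8 := fun x y => inferInstanceAs (Decidable (y ∈ above x))

/-- The join. -/
def join (x y : M8) : M8 :=
  if x ≤ y then y else if y ≤ x then x else if x ≤ d ∧ y ≤ d then d else t

/-- The meet. -/
def meet (x y : M8) : M8 :=
  if x ≤ y then x else if y ≤ x then y else if c ≤ x ∧ c ≤ y then c else o

instance : Lattice M8 where
  le_refl := by decide
  le_trans := by decide
  le_antisymm := by decide
  sup := join
  inf := meet
  le_sup_left := by decide
  le_sup_right := by decide
  sup_le := by decide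
  inf_le_left := by decide
  inf_le_right := by decide
  le_inf := by decide

end M8

/-- The elements `x, y, z` have the pairwise meet `p` and the pairwise join `q`. -/
structure IsDiamond {X : Type} [Lattice X] (p x y z q : X) : Prop where
  sup_xy : x ⊔ y = q
  sup_xz : x ⊔ z = q
  sup_yz : y ⊔ z = q
  inf_xy : x ⊓ y = p
  inf_xz : x ⊓ z = p
  inf_yz : y ⊓ z = p

theorem IsDiamond.refl {X : Type} [Lattice X] (x : X) : IsDiamond x x x x x := by
  constructor <;> simp

theorem IsDiamond.prod {X Y : Type} [Lattice X] [Lattice Y] {p x y z q : X} {p' x' y' z' q' : Y}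
    (h : IsDiamond p x y z q) (h' : IsDiamond p' x' y' z' q') :
    IsDiamond (p, p') (x, x') (y, y') (z, z') (q, q') :=
  ⟨Prod.ext h.1 h'.1, Prod.ext h.2 h'.2, Prod.ext h.3 h'.3, Prod.ext h.4 h'.4,
    Prod.ext h.5 h'.5, Prod.ext h.6 h'.6⟩

theorem IsDiamond.pi {I : Type} {X : Type} [Lattice X] {p x y z q : I → X}
    (h : ∀ i, IsDiamond (p i) (x i) (y i) (z i) (q i)) : IsDiamond p x y z q :=
  ⟨funext fun i => (h i).1, funext fun i => (h i).2, funext fun i => (h i).3,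
    funext fun i => (h i).4, funext fun i => (h i).5, funext fun i => (h i).6⟩

theorem IsDiamond.of_coe {X : Type} [Lattice X] {S : Sublattice X} {p x y z q : S}
    (h : IsDiamond (p : X) x y z q) : IsDiamond p x y z q :=
  ⟨Subtype.ext h.1, Subtype.ext h.2, Subtype.ext h.3, Subtype.ext h.4, Subtype.ext h.5,
    Subtype.ext h.6⟩

theorem IsDiamond.map {X Y : Type} [Lattice X] [Lattice Y] {p x y z q : X}
    (h : IsDiamond p x y z q) (f : X → Y) (hi : ∀ x y, f (x ⊓ y) = f x ⊓ f y)
    (hs : ∀ x y, f (x ⊔ y) = f x ⊔ f y) : IsDiamond (f p) (f x) (f y) (f z) (f q) := by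
  constructor
  · rw [← hs, h.1]
  · rw [← hs, h.2]
  · rw [← hs, h.3]
  · rw [← hi, h.4]
  · rw [← hi, h.5]
  · rw [← hi, h.6]

theorem M8.isDiamond_lower : IsDiamond M8.o M8.a M8.b M8.c M8.d := by constructor <;> rfl

theorem M8.isDiamond_upper : IsDiamond M8.c M8.d M8.p M8.q M8.t := by constructor <;> rfl

namespace M33

theorem l0_le : ∀ x : M33, l0 ≤ x := by decide

theorem isDiamond_lower : IsDiamond l0 la lb lc l1 := by constructor <;> rfl

theorem eq_of_sup_inf_eq : ∀ x y z : M33,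
    (x ⊔ y = x ⊔ z ∧ x ⊔ y = y ⊔ z) ∧ (x ⊓ y = x ⊓ z ∧ x ⊓ y = y ⊓ z) →
    (x = y ∧ y = z) ∨ (x ⊓ y = l0 ∧ z ∈ [la, lb, lc]) ∨ (x ⊓ y = u0 ∧ z ∈ [ua, ub, uc]) := by
  decide +kernel

/-- In `M₃₋₃`, any three elements with the same pairwise joins and meets, not all equal, are the
atoms of one of the two copies of `M₃`. -/
theorem eq_of_isDiamond {p x y z q : M33} (h : IsDiamond p x y z q) :
    (p = z ∧ p = q) ∨ (p = l0 ∧ z ∈ [la, lb, lc]) ∨ (p = u0 ∧ z ∈ [ua, ub, uc]) := by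
  have := eq_of_sup_inf_eq x y z
    ⟨⟨h.1.trans h.2.symm, h.1.trans h.3.symm⟩, ⟨h.4.trans h.5.symm, h.4.trans h.6.symm⟩⟩
  rw [h.4] at this
  rcases this with ⟨h1, h2⟩ | h
  · left
    subst h1 h2
    rw [← h.1, ← h.4]
    simp
  · exact Or.inr h

theorem ne_u0_of_le : ∀ x y : M33, x ∈ [la, lb, lc] ∨ x ∈ [ua, ub, uc] → y = l0 ∨ y = u0 →
    x ≤ y → x = lc ∧ y = u0 := by
  decide +kernel

end M33

/-! ### Linear sums of copies of `M₃` inserted into the edge `c < d` of `M8` -/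

namespace Belkin

open M33

variable {n : ℕ}

/-- The defining condition of the Belkin lattices: `z` is an element of a linear sum of `n` copies
of `M₃`, which is trivial outside of the edge `c < d` of `M8`. -/
structure Mem (v : M8 × (Fin n → M33)) : Prop where
  le (i : Fin n) : v.2 i ≤ l1
  lower (h : ¬ M8.c ≤ v.1) (i : Fin n) : v.2 i = l0
  upper (h : ¬ v.1 ≤ M8.d) (i : Fin n) : v.2 i = l1
  chain (i j : Fin n) (h : i < j) : v.2 i = l1 ∨ v.2 j = l0

theorem Mem.sup {v w : M8 × (Fin n → M33)} (hv : Mem v) (hw : Mem w) : Mem (v ⊔ w) where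
  le i := sup_le (hv.le i) (hw.le i)
  lower h i := by
    have h1 := hv.lower (fun h' => h (h'.trans le_sup_left)) i
    have h2 := hw.lower (fun h' => h (h'.trans le_sup_right)) i
    change v.2 i ⊔ w.2 i = l0
    rw [h1, h2, sup_idem]
  upper h i := by
    change v.2 i ⊔ w.2 i = l1
    by_cases hv' : v.1 ≤ M8.d
    · have h2 := hw.upper (fun hw' => h (sup_le hv' hw')) i
      rw [h2, sup_eq_right.2 (hv.le i)]
    · rw [hv.upper hv' i, sup_eq_left.2 (hw.le i)]
  chain i j h := by
    change v.2 i ⊔ w.2 i = l1 ∨ v.2 j ⊔ w.2 j = l0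
    rcases hv.chain i j h with h1 | h1
    · exact Or.inl (by rw [h1, sup_eq_left.2 (hw.le i)])
    · rcases hw.chain i j h with h2 | h2
      · exact Or.inl (by rw [h2, sup_eq_right.2 (hv.le i)])
      · exact Or.inr (by rw [h1, h2, sup_idem])

theorem Mem.inf {v w : M8 × (Fin n → M33)} (hv : Mem v) (hw : Mem w) : Mem (v ⊓ w) where
  le i := inf_le_left.trans (hv.le i)
  lower h i := by
    change v.2 i ⊓ w.2 i = l0
    by_cases hv' : M8.c ≤ v.1
    · have h2 := hw.lower (fun hw' => h (le_inf hv' hw')) i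
      rw [h2, inf_eq_right.2 (l0_le _)]
    · rw [hv.lower hv' i, inf_eq_left.2 (l0_le _)]
  upper h i := by
    have h1 := hv.upper (fun h' => h (inf_le_left.trans h')) i
    have h2 := hw.upper (fun h' => h (inf_le_right.trans h')) i
    change v.2 i ⊓ w.2 i = l1
    rw [h1, h2, inf_idem]
  chain i j h := by
    change v.2 i ⊓ w.2 i = l1 ∨ v.2 j ⊓ w.2 j = l0
    rcases hv.chain i j h with h1 | h1
    · rcases hw.chain i j h with h2 | h2
      · exact Or.inl (by rw [h1, h2, inf_idem])
      · exact Or.inr (by rw [h2, inf_eq_right.2 (l0_le _)])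
    · exact Or.inr (by rw [h1, inf_eq_left.2 (l0_le _)])

variable (n) in
/-- The `n`th Belkin lattice. -/
def lattice : Sublattice (M8 × (Fin n → M33)) where
  carrier := {v | Mem v}
  supClosed' := fun _ hv _ hw => hv.sup hw
  infClosed' := fun _ hv _ hw => hv.inf hw

/-- The coordinate `i` of `v` is an extreme element of the lower `M₃`. -/
def Extreme (i : Fin n) (v : M8 × (Fin n → M33)) : Prop := v.2 i = l0 ∨ v.2 i = l1

theorem extreme_unique {v : M8 × (Fin n → M33)} (hv : Mem v) {i j : Fin n}
    (hi : ¬ Extreme i v) (hj : ¬ Extreme j v) : i = j := by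
  rcases lt_trichotomy i j with h | h | h
  · rcases hv.chain i j h with h | h
    · exact absurd (Or.inr h) hi
    · exact absurd (Or.inl h) hj
  · exact h
  · rcases hv.chain j i h with h | h
    · exact absurd (Or.inr h) hj
    · exact absurd (Or.inl h) hi

/-- The sublattice of elements whose coordinate `i` is extreme. -/
def part (i : Fin n) : Sublattice (M8 × (Fin n → M33)) where
  carrier := {v | Mem v ∧ Extreme i v}
  supClosed' := fun v hv w hw => ⟨hv.1.sup hw.1, by
    change v.2 i ⊔ w.2 i = l0 ∨ v.2 i ⊔ w.2 i = l1
    rcases hv.2 with h | h <;> rcases hw.2 with h' | h' <;> rw [h, h'] <;> decide⟩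
  infClosed' := fun v hv w hw => ⟨hv.1.inf hw.1, by
    change v.2 i ⊓ w.2 i = l0 ∨ v.2 i ⊓ w.2 i = l1
    rcases hv.2 with h | h <;> rcases hw.2 with h' | h' <;> rw [h, h'] <;> decide⟩

/-- The map from `M8` and an extreme element of the lower `M₃` to `M₃₋₃`. -/
def glue (x : M8) (w : M33) : M33 :=
  match x with
  | .o => l0
  | .a => la
  | .b => lb
  -- Below the chosen copy the edge `c < d` goes to `lc < l1`, above it to `u0 < ua`.
  | .c => if w = l1 then u0 else lc
  | .d => if w = l1 then ua else l1
  | .p => ub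
  | .q => uc
  | .t => u1

theorem glue_injective : ∀ (w : M33) (x y : M8), glue x w = glue y w → x = y := by decide +kernel

theorem glue_hom : ∀ (x y : M8) (v w : M33), (v = l0 ∨ v = l1) → (w = l0 ∨ w = l1) →
    (¬ M8.c ≤ x → v = l0) → (¬ x ≤ M8.d → v = l1) → (¬ M8.c ≤ y → w = l0) →
    (¬ y ≤ M8.d → w = l1) → glue (x ⊓ y) (v ⊓ w) = glue x v ⊓ glue y w ∧
      glue (x ⊔ y) (v ⊔ w) = glue x v ⊔ glue y w := by
  decide +kernel

/-- Elements differing in the linear sum are separated by a coordinate. Otherwise they differ in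
`M8`, and `glue` along the coordinate `i` separates them; it is a homomorphism because that
coordinate is only `l0` or `l1`. -/
theorem quasi_part (i : Fin n) (C : List (Equation latticeLanguage))
    (c : Equation latticeLanguage) (h : SatisfiesQuasi M33 C c) :
    SatisfiesQuasi (part i) C c := by
  refine quasi_of_separated (fun v w hvw => ?_) C c h
  by_cases hz : ∃ j, v.1.2 j ≠ w.1.2 j
  · obtain ⟨j, hj⟩ := hz
    exact ⟨latHom (fun v : part i => v.1.2 j) (fun _ _ => rfl) (fun _ _ => rfl), hj⟩
  · push Not at hz
    have key := fun v w : part i => glue_hom v.1.1 w.1.1 (v.1.2 i) (w.1.2 i) v.2.2 w.2.2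
      (fun h => v.2.1.lower h i) (fun h => v.2.1.upper h i) (fun h => w.2.1.lower h i)
      (fun h => w.2.1.upper h i)
    refine ⟨latHom (fun v : part i => glue v.1.1 (v.1.2 i)) (fun v w => (key v w).1)
      (fun v w => (key v w).2), fun heq => hvw ?_⟩
    have heq' : glue v.1.1 (v.1.2 i) = glue w.1.1 (w.1.2 i) := heq
    rw [hz i] at heq'
    exact Subtype.ext (Prod.ext (glue_injective _ _ _ heq') (funext hz))

/-- The element `w` of the `i`th copy of `M₃` in the linear sum. -/
def step (i : ℕ) (w : M33) : Fin n → M33 := fun j => if j < i then l1 else if j = i then w else l0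

theorem isDiamond_step (i : ℕ) : IsDiamond (step i l0 : Fin n → M33) (step i la) (step i lb)
    (step i lc) (step i l1) := by
  refine .pi fun j => ?_
  simp only [step]
  split_ifs
  exacts [.refl _, isDiamond_lower, .refl _]

theorem step_succ (i : ℕ) : (step i l1 : Fin n → M33) = step (i + 1) l0 := by
  funext j
  simp only [step]
  split_ifs <;> first | rfl | omega

theorem inf_step_zero (z : Fin n → M33) : z ⊓ step 0 l0 = step 0 l0 := by
  funext j
  simp [step, l0_le]

theorem mem_step {x : M8} (hx : M8.c ≤ x) (hx' : x ≤ M8.d) (i : ℕ) {w : M33} (hw : w ≤ l1) :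
    Mem (x, (step i w : Fin n → M33)) where
  le j := by
    simp only [step]
    split_ifs
    exacts [le_rfl, hw, l0_le _]
  lower h := absurd hx h
  upper h := absurd hx' h
  chain j k h := by
    have : (j : ℕ) < k := h
    simp only [step]
    split_ifs <;> first | omega | simp

theorem mem_bot {x : M8} (hx : x ≤ M8.d) : Mem (x, (step 0 l0 : Fin n → M33)) where
  le j := by simp [step, l0_le]
  lower h j := by simp [step]
  upper h := absurd hx h
  chain j k h := by simp [step]

theorem mem_top {x : M8} (hx : M8.c ≤ x) : Mem (x, (step n l0 : Fin n → M33)) where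
  le j := by simp [step]
  lower h := absurd hx h
  upper h j := by simp [step]
  chain j k h := by simp [step]

/-- The elements below the linear sum of copies of `M₃`. -/
def bot (x : M8) (hx : x ≤ M8.d) : lattice n := ⟨(x, step 0 l0), mem_bot hx⟩

/-- The elements above the linear sum of copies of `M₃`. -/
def top (x : M8) (hx : M8.c ≤ x) : lattice n := ⟨(x, step n l0), mem_top hx⟩

/-- The elements of the linear sum of copies of `M₃`. -/
def mid (i : ℕ) (w : M33) (hw : w ≤ l1) : lattice n :=
  ⟨(M8.c, step i w), mem_step le_rfl (by decide) i hw⟩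

/-- Homomorphisms to `M₃₋₃` do not separate the elements `(c, 0)` and `(d, 0)` of a Belkin
lattice. -/
theorem hom_eq (f : lattice n → M33) (hi : ∀ x y, f (x ⊓ y) = f x ⊓ f y)
    (hs : ∀ x y, f (x ⊔ y) = f x ⊔ f y) :
    f (bot M8.c (by decide)) = f (bot M8.d le_rfl) := by
  by_contra hne
  have hlow := eq_of_isDiamond ((IsDiamond.of_coe (p := bot (n := n) M8.o (by decide))
    (x := bot M8.a (by decide)) (y := bot M8.b (by decide)) (z := bot M8.c (by decide))
    (q := bot M8.d le_rfl) (M8.isDiamond_lower.prod (.refl _))).map f hi hs)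
  have hup := eq_of_isDiamond ((IsDiamond.of_coe (p := top (n := n) M8.c le_rfl)
    (x := top M8.d (by decide)) (y := top M8.p (by decide)) (z := top M8.q (by decide))
    (q := top M8.t (by decide)) (M8.isDiamond_upper.prod (.refl _))).map f hi hs)
  have hcd : f (top M8.c le_rfl) ≤ f (top M8.d (by decide)) ∧
      f (top M8.d (by decide)) ≤ f (top M8.t (by decide)) := by
    constructor <;> rw [← inf_eq_left, ← hi] <;>
      exact congrArg f (Subtype.ext (Prod.ext rfl (inf_idem _)))
  have hct : f (top M8.c le_rfl) ⊓ f (bot M8.d le_rfl) = f (bot M8.c (by decide)) := by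
    rw [← hi]
    exact congrArg f (Subtype.ext (Prod.ext rfl (inf_step_zero _)))
  have hdt : f (top M8.d (by decide)) ⊓ f (bot M8.d le_rfl) = f (bot M8.d le_rfl) := by
    rw [← hi]
    exact congrArg f (Subtype.ext (Prod.ext rfl (inf_step_zero _)))
  -- The bottom of each successive diamond goes to `lc`, which is neither `l0` nor `u0`, so the
  -- image of the diamond collapses and its top goes to `lc` as well.
  have hmid : ∀ i, f (mid 0 l0 (l0_le _)) = lc → f (mid i l0 (l0_le _)) = lc := by
    intro i h0
    induction i with
    | zero => exact h0
    | succ i ih =>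
      have e : f (mid (i + 1) l0 (l0_le _)) = f (mid i l1 le_rfl) :=
        congrArg f (Subtype.ext (Prod.ext rfl (step_succ i).symm))
      have := eq_of_isDiamond ((IsDiamond.of_coe (p := mid (n := n) i l0 (l0_le _))
        (x := mid i la (by decide)) (y := mid i lb (by decide)) (z := mid i lc (by decide))
        (q := mid i l1 le_rfl) ((IsDiamond.refl _).prod (isDiamond_step i))).map f hi hs)
      rw [ih] at this
      rcases this with h | h | h
      · rw [e, ← h.2]
      · exact absurd h.1 (by decide)
      · exact absurd h.1 (by decide)
  -- The two ends of the sum are `mid 0 l0` and `mid n l0`: at index `n`, one past the last copy,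
  -- all coordinates are `l1`.
  have hmid' : f (bot M8.c (by decide)) = lc → f (top M8.c le_rfl) = lc := hmid n
  have hx : f (bot M8.c (by decide)) ∈ [la, lb, lc] ∨ f (bot M8.c (by decide)) ∈ [ua, ub, uc] := by
    rcases hlow with h | h | h
    · exact absurd (h.1.symm.trans h.2) hne
    · exact Or.inl h.2
    · exact Or.inr h.2
  -- If the upper diamond collapsed, meeting `(c, 1)` and `(d, 1)` with `(d, 0)` would identify the
  -- images of `(c, 0)` and `(d, 0)`.
  have hy : f (top M8.c le_rfl) = l0 ∨ f (top M8.c le_rfl) = u0 := by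
    rcases hup with h | h | h
    · have e : f (top M8.d (by decide)) = f (top M8.c le_rfl) :=
        le_antisymm (hcd.2.trans h.2.ge) hcd.1
      rw [e, hct] at hdt
      exact absurd hdt hne
    · exact Or.inl h.1
    · exact Or.inr h.1
  -- An atom of a copy lies below the bottom of a copy only at `lc < u0`, whereas `hmid'` keeps the
  -- image at `lc`.
  have := ne_u0_of_le _ _ hx hy (by rw [← hct]; exact inf_le_left)
  rw [hmid' this.1] at this
  exact absurd this.2 (by decide)

/-- Pigeonhole: each of the at most `N` elements spoils at most one of the `N + 1` coordinates. -/
theorem exists_extreme {α : Type} {N : ℕ} (Y : Finset α) (hY : Y.card ≤ N)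
    (P : α → Fin (N + 1) → Prop) (hP : ∀ y i j, ¬ P y i → ¬ P y j → i = j) :
    ∃ i, ∀ y ∈ Y, P y i := by
  by_contra! hcon
  choose y hy hyP using hcon
  have := Fintype.card_le_of_injective (fun i => (⟨y i, hy i⟩ : Y)) fun i j hij =>
    hP (y i) i j (hyP i) (by rw [Subtype.mk.inj hij]; exact hyP j)
  simp at this
  omega

end Belkin

/-! ### Failure of `∀*∃*` axiomatisability -/

section Failure

/-- An embedding of lattices, as an embedding of algebras. -/
theorem exists_latticeEmbedding {T D : Type} [Lattice T] [Lattice D] (f : LatticeHom T D)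
    (hf : Function.Injective f) : ∃ g : T ↪[latticeLanguage] D, ∀ x, g x = f x :=
  ⟨Embedding.ofInjective (f := latHom f (map_inf f) (map_sup f)) hf, fun _ => rfl⟩

/-- An embedding of lattices induces an embedding of the flat extensions. -/
theorem exists_flatEmbedding {T D : Type} [Lattice T] [Lattice D] (f : LatticeHom T D)
    (hf : Function.Injective f) : ∃ g : Flat T ↪[flatLat] Flat D, ∀ x, g x = Option.map f x := by
  have hinj : Function.Injective (Option.map f) := Option.map_injective hf
  refine ⟨Embedding.ofInjective (f := flatHom (S := Flat T) (T := Flat D) (Option.map f) rfl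
    (fun x y => ?_) (fun x y => ?_) (fun x y => ?_)) hinj, fun _ => rfl⟩
  · by_cases h : x = y
    · rw [h, fmeet_self_flat, fmeet_self_flat]
    · rw [fmeet_ne_flat h, fmeet_ne_flat fun h' => h (hinj h')]
      rfl
  · cases x <;> cases y <;> simp
  · cases x <;> cases y <;> simp

instance (n : ℕ) : Nonempty (Belkin.lattice n) := ⟨Belkin.bot M8.d le_rfl⟩

instance {n : ℕ} (i : Fin n) : Nonempty (Belkin.part i) :=
  ⟨⟨_, Belkin.mem_bot (x := M8.d) le_rfl, by simp [Belkin.Extreme, Belkin.step]⟩⟩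

instance : Nonempty M33 := ⟨M33.l0⟩

theorem Belkin.not_quasi (n : ℕ) : ¬ ∀ C c, SatisfiesQuasi (L := latticeLanguage) M33 C c →
    SatisfiesQuasi (Belkin.lattice n) C c := by
  intro h
  have hne : (Belkin.bot M8.c (by decide) : Belkin.lattice n) ≠ Belkin.bot M8.d le_rfl := by
    intro h
    have h' : M8.c = M8.d := congrArg (fun v : Belkin.lattice n => v.1.1) h
    cases h'
  obtain ⟨f, hf, hi, hs⟩ := exists_hom_of_quasi h hne
  exact hf (Belkin.hom_eq f hi hs)

/-- The inclusion of a part of a Belkin lattice. -/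
def Belkin.partHom {n : ℕ} (i : Fin n) : LatticeHom (Belkin.part i) (Belkin.lattice n) where
  toFun v := ⟨v.1, v.2.1⟩
  map_sup' _ _ := rfl
  map_inf' _ _ := rfl

theorem Belkin.partHom_injective {n : ℕ} (i : Fin n) : Function.Injective (Belkin.partHom i) :=
  fun _ _ h => Subtype.ext (congrArg (fun v : Belkin.lattice n => v.1) h)

/-- The universal Horn theory of `M₃₋₃` has no finite basis. -/
theorem not_hasFiniteUniversalHornBasis_M33 :
    ¬ HasFiniteUniversalHornBasis latticeLanguage M33 := by
  rintro ⟨T, hT, H⟩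
  obtain ⟨N, hN⟩ := exists_bound_of_finset (Γ := T) fun φ hφ =>
    isForallExists_of_isUniversal (hT φ hφ).1.isUniversal
  refine Belkin.not_quasi (N + 1) fun C c hC => ?_
  obtain ⟨ψ, hψ, hψM⟩ := exists_hornSentence C c
  refine (hψM _).1 (H _ (hN _ fun Y hY => ?_) ψ hψ ((hψM _).2 hC))
  -- The tested elements all lie in the part whose coordinate `i` is extreme, and this part
  -- satisfies the quasi-identities of `M33`.
  obtain ⟨i, hi⟩ := Belkin.exists_extreme Y hY (fun v i => Belkin.Extreme i v.1)
    fun v i j => Belkin.extreme_unique v.2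
  obtain ⟨g, hg⟩ := exists_latticeEmbedding _ (Belkin.partHom_injective i)
  refine ⟨Belkin.part i, _, g, fun y hy => ⟨⟨y.1, y.2, hi y hy⟩, (hg _).trans rfl⟩, fun φ hφ =>
    models_of_quasi (Belkin.quasi_part i) (hT φ hφ).1 (hT φ hφ).2⟩

/-- Finitely many `∀*∃*` sentences that hold in the finite members of the variety of the flat
extension of `M₃₋₃` have a finite model outside of this variety. -/
theorem exists_finite_model {Γ : Finset flatLat.Sentence} (hΓ : ∀ φ ∈ Γ, IsForallExists φ)
    (h : ∀ φ ∈ Γ, ∀ (A : Type) [Finite A] [Nonempty A] [flatLat.Structure A],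
      MemVariety flatLat (Flat M33) A → A ⊨ φ) :
    ∃ (A : Type) (_ : Finite A) (_ : Nonempty A) (_ : flatLat.Structure A),
      (∀ φ ∈ Γ, A ⊨ φ) ∧ ¬ MemVariety flatLat (Flat M33) A := by
  obtain ⟨N, hN⟩ := exists_bound_of_finset hΓ
  refine ⟨Flat (Belkin.lattice (N + 1)), inferInstance, inferInstance, inferInstance,
    hN _ fun Y hY => ?_, fun hM => Belkin.not_quasi (N + 1) (memVariety_flat_iff.1 hM)⟩
  obtain ⟨i, hi⟩ := Belkin.exists_extreme Y hY
    -- The element 0 is vacuously extreme in every coordinate.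
    (fun y i => ∀ v, y = some v → Belkin.Extreme i v.1) fun y i j h1 h2 => by
      push Not at h1 h2
      obtain ⟨v, rfl, hv⟩ := h1
      obtain ⟨w, hw, hw'⟩ := h2
      cases hw
      exact Belkin.extreme_unique v.2 hv hw'
  obtain ⟨g, hg⟩ := exists_flatEmbedding _ (Belkin.partHom_injective i)
  refine ⟨Flat (Belkin.part i), _, g, fun y hy => ?_, fun φ hφ =>
    h φ hφ _ (memVariety_flat_iff.2 (Belkin.quasi_part i))⟩
  cases y with
  | none => exact ⟨none, hg _⟩
  | some v => exact ⟨some ⟨v.1, v.2, hi _ hy v rfl⟩, hg _⟩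

variable {Φ : flatLat.Sentence} (hΦ : DefinesFiniteMembers (Flat M33) Φ)

include hΦ

theorem not_forallExists_finEquivalent :
    ¬ ∃ Ψ : flatLat.Sentence, IsForallExists Ψ ∧ FinEquivalent Φ Ψ := by
  rintro ⟨Ψ, hΨ, he⟩
  obtain ⟨A, _, _, _, hA, hn⟩ := exists_finite_model (Γ := {Ψ}) (by simpa using hΨ) (by
    simp only [Finset.mem_singleton, forall_eq]
    exact fun A _ _ _ hA => (he A).1 ((hΦ A).2 hA))
  exact hn ((hΦ A).1 ((he A).2 (hA Ψ (by simp))))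

theorem not_finite_equations : ¬ ∃ E : Finset (Equation flatLat),
    ∀ (A : Type) [Finite A] [Nonempty A] [flatLat.Structure A],
      A ⊨ Φ ↔ ∀ e ∈ E, SatisfiesEquation A e := by
  classical
  rintro ⟨E, hE⟩
  choose σ hσ hσM using exists_equationSentence (L := flatLat)
  obtain ⟨A, _, _, _, hA, hn⟩ := exists_finite_model (Γ := E.image σ)
    (by
      simp only [Finset.mem_image, forall_exists_index, and_imp, forall_apply_eq_imp_iff₂]
      exact fun e _ => isForallExists_of_isUniversal (hσ e).isUniversal)
    (by
      simp only [Finset.mem_image, forall_exists_index, and_imp, forall_apply_eq_imp_iff₂]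
      exact fun e he A _ _ _ hA => (hσM e A).2 ((hE A).1 ((hΦ A).2 hA) e he))
  exact hn ((hΦ A).1 ((hE A).2 fun e he => (hσM e A).1 (hA _ (Finset.mem_image_of_mem σ he))))

theorem finClosedS : FinClosedS Φ := by
  rintro A B _ _ _ _ _ _ ⟨f⟩ hB
  rw [hΦ, memVariety_iff] at hB ⊢
  exact fun e he => (hB e he).of_injective f.toHom f.injective

theorem finClosedP : FinClosedP Φ := by
  intro I _ A _ _ _ hA
  rw [hΦ, memVariety_iff]
  exact fun e he => .pi fun i => memVariety_iff.1 ((hΦ (A i)).1 (hA i)) e he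

theorem finClosedH : FinClosedH Φ := by
  intro A B _ _ _ _ _ _ f hf hA
  rw [hΦ, memVariety_iff] at hA ⊢
  exact fun e he => (hA e he).of_surjective f hf

end Failure

instance : Finite (Σ n, flatLat.Functions n) := by
  let f : Fin 4 → Σ n, flatLat.Functions n :=
    ![⟨0, zeroSymbol⟩, ⟨2, meetSymbol⟩, ⟨2, origSymbol infSymbol⟩, ⟨2, origSymbol supSymbol⟩]
  refine Finite.of_surjective f ?_
  rintro ⟨n, g⟩
  rcases g with g | g <;> rcases g with _ | _
  exacts [⟨2, rfl⟩, ⟨3, rfl⟩, ⟨0, rfl⟩, ⟨1, rfl⟩]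

end FlatLattice

theorem mainTheorem2 :
    -- the general result, for every finite lattice without a finite universal Horn basis
    (∀ (A : Type) [Lattice A] [Finite A] [Nonempty A],
      ¬ FlatLattice.HasFiniteUniversalHornBasis FlatLattice.latticeLanguage A →
        ¬ FlatLattice.VarietyFinitelyBased
            (FlatLattice.flatLanguage FlatLattice.latticeLanguage) (FlatLattice.Flat A) ∧
        ¬ FlatLattice.VarietyFirstOrderAxiomatisable
            (FlatLattice.flatLanguage FlatLattice.latticeLanguage) (FlatLattice.Flat A) ∧
        ∃ Φ : (FlatLattice.flatLanguage FlatLattice.latticeLanguage).Sentence,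
          FlatLattice.IsForallExistsForall Φ ∧
          FlatLattice.DefinesFiniteMembers (FlatLattice.Flat A) Φ) ∧
    -- Belkin's lattice is an example
    ¬ FlatLattice.HasFiniteUniversalHornBasis FlatLattice.latticeLanguage FlatLattice.M33 ∧
    -- negative answer to the first order Eilenberg–Schützenberger problem
    ¬ FlatLattice.FirstOrderEilenbergSchutzenberger ∧
    -- simultaneous failure of the three preservation theorems at the finite level
    ∃ Φ : (FlatLattice.flatLanguage FlatLattice.latticeLanguage).Sentence,
      FlatLattice.IsForallExistsForall Φ ∧
      FlatLattice.DefinesFiniteMembers (FlatLattice.Flat FlatLattice.M33) Φ ∧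
      ¬ FlatLattice.FinLosTarskiAt Φ ∧
      ¬ FlatLattice.FinSPPreservationAt Φ ∧
      ¬ FlatLattice.FinHSPPreservationAt Φ ∧
      ¬ ∃ Ψ : (FlatLattice.flatLanguage FlatLattice.latticeLanguage).Sentence,
          FlatLattice.IsForallExists Ψ ∧ FlatLattice.FinEquivalent Φ Ψ := by
  open FlatLattice in
  refine ⟨fun A _ _ _ hA => ⟨fun h => hA h.hasFiniteUniversalHornBasis,
    fun h => hA h.finitelyBased.hasFiniteUniversalHornBasis, exists_definesFiniteMembers A⟩,
    not_hasFiniteUniversalHornBasis_M33, fun h => ?_, ?_⟩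
  · obtain ⟨Φ, -, hΦ⟩ := exists_definesFiniteMembers M33
    exact h flatLat (Flat M33) (fun h => not_hasFiniteUniversalHornBasis_M33
      h.finitelyBased.hasFiniteUniversalHornBasis) ⟨Φ, hΦ⟩
  · obtain ⟨Φ, hΦ', hΦ⟩ := exists_definesFiniteMembers M33
    -- Universal and universal Horn sentences are `∀*∃*`, so the last clause also refutes the
    -- Łoś–Tarski and `SP` instances; the `HSP` instance is refuted by translating equations into
    -- universal Horn sentences.
    refine ⟨Φ, hΦ', hΦ, fun h => ?_, fun h => ?_,
      fun h => not_finite_equations hΦ (h ⟨finClosedH hΦ, finClosedS hΦ, finClosedP hΦ⟩),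
      not_forallExists_finEquivalent hΦ⟩
    · obtain ⟨Ψ, hΨ, he⟩ := h (finClosedS hΦ)
      exact not_forallExists_finEquivalent hΦ ⟨Ψ, isForallExists_of_isUniversal hΨ, he⟩
    · obtain ⟨Ψ, hΨ, he⟩ := h ⟨finClosedS hΦ, finClosedP hΦ⟩
      exact not_forallExists_finEquivalent hΦ
        ⟨Ψ, isForallExists_of_isUniversal hΨ.isUniversal, he⟩
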